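/- Let $k\ge 0$ and let $C=\{1,\dots,k\}$ be a set of $k$ colors. For a finite simple graph $G=(V,E)$ and lists $L(v)\subseteq C$ $(v\in V)$, an $L$-coloring is a map $f\colon V\to C$ with $f(v)\in L(v)$ for all $v\in V$ and $f(v)\ne f(w)$ for all $vw\in E$. A reconfiguration sequence of length $\ell$ between two $L$-colorings $f$ and $g$ is a sequence $f=f_0,f_1,\dots,f_\ell=g$ of $L$-colorings in which $f_{i-1}$ and $f_i$ differ on exactly one vertex for each $i\in\{1,\dots,\ell\}$. The problem List Coloring Shortest Reconfiguration asks, given $I=(G,L,f_{\mathrm{ini}},f_{\mathrm{tar}})$ with $L$-colorings $f_{\mathrm{ini}}$ and $f_{\mathrm{tar}}$ of $G$, for the minimum length $\mathrm{OPT}(I)\in\mathbb{N}\cup\{+\infty\}$ of a reconfiguration sequence between $f_{\mathrm{ini}}$ and $f_{\mathrm{tar}}$, where $\mathrm{OPT}(I)=+\infty$ if there is none. A graph is split if its vertex set can be partitioned into a clique and an independent set. List Coloring Shortest Reconfiguration is fixed-parameter tractable for split graphs when parameterized by the size $k$ of the color set. That is, there are an algorithm, a computable function $\phi\colon\mathbb{N}\to\mathbb{N}$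 and a constant $c$ such that, for every $k$ and every instance $I$ with $k$ colors whose graph is split, the algorithm computes $\mathrm{OPT}(I)$ in at most $\phi(k)\cdot|I|^{c}$ steps, where $|I|$ is the size of the encoding of $I$. -/

import Mathlib

/-! ### Random access machines

Programs of a random access machine over `ℕ` with structured control flow. A memory state consists
of registers and of arrays of unbounded length with indirect addressing (each program mentions only
finitely many registers and arrays). The arithmetic instructions are addition and truncated
subtraction, with the uniform cost measure; there is no unit-cost multiplication, so the model is
polynomially equivalent to Turing machines. -/

namespace RAM

/-- Memory: `reg x` is the content of register `x`, `arr a i` is the `i`-th cell of array `a`. -/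
structure State where
  reg : ℕ → ℕ
  arr : ℕ → ℕ → ℕ

/-- Write `v` to register `x`. -/
def State.setReg (s : State) (x v : ℕ) : State :=
  { s with reg := Function.update s.reg x v }

/-- Write `v` to cell `i` of array `a`. -/
def State.setArr (s : State) (a i v : ℕ) : State :=
  { s with arr := Function.update s.arr a (Function.update (s.arr a) i v) }

/-- Arithmetic expressions. -/
inductive Expr where
  | const (n : ℕ)
  | reg (x : ℕ)
  | read (a : ℕ) (i : Expr)
  | add (e₁ e₂ : Expr)
  | sub (e₁ e₂ : Expr)

/-- The value of an expression; subtraction is truncated at `0`. -/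
def Expr.eval (s : State) : Expr → ℕ
  | .const n => n
  | .reg x => s.reg x
  | .read a i => s.arr a (i.eval s)
  | .add e₁ e₂ => e₁.eval s + e₂.eval s
  | .sub e₁ e₂ => e₁.eval s - e₂.eval s

/-- The cost of evaluating an expression: one step for each symbol in it. -/
def Expr.cost : Expr → ℕ
  | .const _ => 1
  | .reg _ => 1
  | .read _ i => i.cost + 1
  | .add e₁ e₂ => e₁.cost + e₂.cost + 1
  | .sub e₁ e₂ => e₁.cost + e₂.cost + 1

/-- Programs. A test `e` succeeds if the value of `e` is nonzero. -/
inductive Program where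
  | skip
  | assign (x : ℕ) (e : Expr)
  | store (a : ℕ) (i e : Expr)
  | seq (p q : Program)
  | ite (e : Expr) (p q : Program)
  | loop (e : Expr) (p : Program)

/-- `Run p s t s'`: started in the memory state `s`, the program `p` halts after exactly `t` steps
in the memory state `s'`. Here `ite e p q` is `if e ≠ 0 then p else q` and `loop e p` is
`while e ≠ 0 do p`. -/
inductive Run : Program → State → ℕ → State → Prop where
  | skip (s : State) : Run .skip s 1 s
  | assign (x : ℕ) (e : Expr) (s : State) :
      Run (.assign x e) s (e.cost + 1) (s.setReg x (e.eval s))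
  | store (a : ℕ) (i e : Expr) (s : State) :
      Run (.store a i e) s (i.cost + e.cost + 1) (s.setArr a (i.eval s) (e.eval s))
  | seq {p q : Program} {s s' s'' : State} {t t' : ℕ}
      (hp : Run p s t s') (hq : Run q s' t' s'') : Run (.seq p q) s (t + t') s''
  | ite_true {e : Expr} {p q : Program} {s s' : State} {t : ℕ}
      (he : e.eval s ≠ 0) (hp : Run p s t s') : Run (.ite e p q) s (e.cost + 1 + t) s'
  | ite_false {e : Expr} {p q : Program} {s s' : State} {t : ℕ}
      (he : e.eval s = 0) (hq : Run q s t s') : Run (.ite e p q) s (e.cost + 1 + t) s'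
  | loop_true {e : Expr} {p : Program} {s s' s'' : State} {t t' : ℕ}
      (he : e.eval s ≠ 0) (hp : Run p s t s') (hl : Run (.loop e p) s' t' s'') :
      Run (.loop e p) s (e.cost + 1 + t + t') s''
  | loop_false {e : Expr} {p : Program} {s : State} (he : e.eval s = 0) :
      Run (.loop e p) s (e.cost + 1) s

/-- The initial memory on input `w`: the words of `w` are in array `0`, the number of words is in
register `0`, and all other memory is `0`. -/
def State.init (w : List ℕ) : State where
  reg := fun x => if x = 0 then w.length else 0
  arr := fun a i => if a = 0 then w.getD i 0 else 0

/-- The answer read off from the memory after halting, an element of `ℕ ∪ {∞}`: it is `∞` if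
register `0` contains `0`, and the content of register `1` otherwise. -/
def State.answer (s : State) : ℕ∞ :=
  if s.reg 0 = 0 then ⊤ else (s.reg 1 : ℕ∞)

/-- On input `w` the program `p` halts after at most `T` steps with the answer `v`. -/
def Program.AnswersWithin (p : Program) (w : List ℕ) (v : ℕ∞) (T : ℕ) : Prop :=
  ∃ (t : ℕ) (s : State), Run p (State.init w) t s ∧ t ≤ T ∧ s.answer = v

end RAM

/-- The problem of computing `value I ∈ ℕ ∪ {∞}` for the instances `I ∈ dom`, encoded by
`enc I`, is fixed-parameter tractable with respect to the parameter `param I`: there are a single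
program, a computable function `f` and a constant `c` such that on every instance `I ∈ dom` the
program gives the right answer within `f (param I) * |I| ^ c` steps, where `|I|` is the number of
words of the encoding of `I`. -/
def IsFixedParameterTractable {ι : Type} (dom : Set ι) (enc : ι → List ℕ) (param : ι → ℕ)
    (value : ι → ℕ∞) : Prop :=
  ∃ (p : RAM.Program) (f : ℕ → ℕ) (c : ℕ), Computable f ∧
    ∀ I ∈ dom, p.AnswersWithin (enc I) (value I) (f (param I) * (enc I).length ^ c)

/-! ### List colorings and their reconfiguration -/

/-- A graph is split if its vertex set can be partitioned into a clique and an independent set. -/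
def SimpleGraph.IsSplitGraph {V : Type*} (G : SimpleGraph V) : Prop :=
  ∃ K : Set V, G.IsClique K ∧ G.IsIndepSet Kᶜ

namespace ListColoring

variable {V C : Type*} {G : SimpleGraph V}

/-- A proper coloring `f` is an `L`-coloring if every vertex has a color from its list. -/
def IsListColoring (L : V → Finset C) (f : G.Coloring C) : Prop :=
  ∀ v, f v ∈ L v

/-- Two colorings are adjacent if they differ on exactly one vertex. -/
def Adjacent (f g : G.Coloring C) : Prop :=
  {v : V | f v ≠ g v}.ncard = 1

/-- `s 0, …, s ℓ` is a reconfiguration sequence (of `L`-colorings) of length `ℓ` between `f`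
and `g`. -/
def IsReconfSeq (L : V → Finset C) (f g : G.Coloring C) (ℓ : ℕ)
    (s : Fin (ℓ + 1) → G.Coloring C) : Prop :=
  s 0 = f ∧ s (Fin.last ℓ) = g ∧ (∀ i, IsListColoring L (s i)) ∧
    ∀ i : Fin ℓ, Adjacent (s i.castSucc) (s i.succ)

/-- The length of a shortest reconfiguration sequence between `f` and `g`, and `∞` if there is no
reconfiguration sequence. -/
noncomputable def shortestLength (L : V → Finset C) (f g : G.Coloring C) : ℕ∞ :=
  ⨅ (ℓ : ℕ) (_ : ∃ s, IsReconfSeq L f g ℓ s), (ℓ : ℕ∞)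

end ListColoring

/-- An instance of list coloring (shortest) reconfiguration: a graph with vertices `0, …, n - 1`,
a color set `0, …, k - 1`, a list for each vertex, and two list colorings. -/
structure ReconfInstance where
  n : ℕ
  k : ℕ
  graph : SimpleGraph (Fin n)
  lists : Fin n → Finset (Fin k)
  ini : graph.Coloring (Fin k)
  tar : graph.Coloring (Fin k)
  ini_mem : ListColoring.IsListColoring lists ini
  tar_mem : ListColoring.IsListColoring lists tar

namespace ReconfInstance

open Classical in
/-- The encoding of an instance as a list of `2 + n ^ 2 + n * k + 2 * n` words, each of which is
`0`, `1`, `n`, `k` or a color: the numbers `n` and `k`, the adjacency matrix row by row, the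
characteristic vector of the list of each vertex, and the two colorings. -/
noncomputable def encode (I : ReconfInstance) : List ℕ :=
  [I.n, I.k] ++
  (List.finRange I.n).flatMap
    (fun v => (List.finRange I.n).map fun w => if I.graph.Adj v w then 1 else 0) ++
  (List.finRange I.n).flatMap
    (fun v => (List.finRange I.k).map fun c => if c ∈ I.lists v then 1 else 0) ++
  (List.finRange I.n).map (fun v => (I.ini v : ℕ)) ++
  (List.finRange I.n).map (fun v => (I.tar v : ℕ))

/-- The solution of list coloring shortest reconfiguration on the instance `I`. -/
noncomputable def opt (I : ReconfInstance) : ℕ∞ :=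
  ListColoring.shortestLength I.lists I.ini I.tar

end ReconfInstance

/-! ### Programs with bounded loops -/

namespace RAM

/-! Call two vertices twins if they have the same neighborhood, list, initial color and target
color. In a split graph the clique has at most `k` vertices, because the initial coloring is
injective on it. A vertex outside the clique is determined up to twins by its list, its two colors
and the set of initial colors of its neighbors. Hence the number `r` of twin classes is bounded in
terms of `k` (`IsClassification.le_classBound`).

Twins are never adjacent. A whole class can therefore be recolored vertex by vertex, at a cost equal
to the number of vertices that change (`reaches_hammingDist`, `reaches_of_iterate_step`).
Conversely, given any reconfiguration sequence, let every vertex copy the twin that is recolored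
least often. All colorings become constant on classes, each step changes at most one class, and the
total number of recolorings does not grow (`exists_walk`). So the optimum is the least weight of a
walk between the two given colorings in a graph with at most `k ^ r` vertices, with the Hamming
distance as weight of an edge. Weights are nonnegative, so paths suffice, and these have fewer than
`k ^ r` edges.

The program numbers the classes and tries all sequences of a fixed number `m ≥ k ^ r` of moves. A
move is a pair (class, color), and a sequence is a natural number read in base `b`, two digits per
move. Successful sequences give upper bounds for the optimum (`opt_le_of_succeeds`), and one of them
is no longer than any given reconfiguration sequence (`le_opt`).

For the running time, the program is written with counting loops only. Its time is then polynomial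
in a common bound for all loop lengths (`exists_run`, `exists_time_le`). That bound is `n` plus a
primitive recursive function of `k`, and a power of such a sum is at most a function of `k` times a
power of the input size. -/

@[simp] theorem State.setReg_reg (s : State) (x v y : ℕ) :
    (s.setReg x v).reg y = if y = x then v else s.reg y := by
  simp [State.setReg, Function.update_apply]

@[simp] theorem State.setReg_arr (s : State) (x v : ℕ) : (s.setReg x v).arr = s.arr := rfl

@[simp] theorem State.setArr_reg (s : State) (a i v : ℕ) : (s.setArr a i v).reg = s.reg := rfl

@[simp] theorem State.setArr_arr (s : State) (a i v b j : ℕ) :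
    (s.setArr a i v).arr b j = if b = a ∧ j = i then v else s.arr b j := by
  by_cases h : b = a
  · subst h
    simp [State.setArr, Function.update_apply]
  · simp [State.setArr, h]

theorem State.setArr_arr_of_ne (s : State) (a i v b : ℕ) (h : b ≠ a) :
    (s.setArr a i v).arr b = s.arr b := by
  simp [State.setArr, h]

attribute [simp] Expr.eval

/-- Programs whose only loops are counting loops: `rep i y p` runs `p` for the values
`0, 1, …, m - 1` of register `i`, where `m` is the content of register `y`. -/
inductive LoopProgram where
  | skip
  | assign (x : ℕ) (e : Expr)
  | store (a : ℕ) (i e : Expr)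
  | seq (p q : LoopProgram)
  | ite (e : Expr) (p q : LoopProgram)
  | rep (i y : ℕ) (p : LoopProgram)

namespace LoopProgram

/-- The memory state after the execution of a program. -/
def exec : LoopProgram → State → State
  | skip, s => s
  | assign x e, s => s.setReg x (e.eval s)
  | store a i e, s => s.setArr a (i.eval s) (e.eval s)
  | seq p q, s => q.exec (p.exec s)
  | ite e p q, s => if e.eval s ≠ 0 then p.exec s else q.exec s
  | rep i y p, s =>
    (fun s' => (p.exec s').setReg i ((p.exec s').reg i + 1))^[s.reg y] (s.setReg i 0)

/-- The translation to random access machines. -/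
def compile : LoopProgram → Program
  | skip => .skip
  | assign x e => .assign x e
  | store a i e => .store a i e
  | seq p q => .seq p.compile q.compile
  | ite e p q => .ite e p.compile q.compile
  | rep i y p => .seq (.assign i (.const 0)) (.loop (.sub (.reg y) (.reg i))
      (.seq p.compile (.assign i (.add (.reg i) (.const 1)))))

/-- The registers a program writes to. -/
def regs : LoopProgram → List ℕ
  | skip => []
  | assign x _ => [x]
  | store _ _ _ => []
  | seq p q => p.regs ++ q.regs
  | ite _ p q => p.regs ++ q.regs
  | rep i _ p => i :: p.regs

/-- The arrays a program writes to. -/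
def arrs : LoopProgram → List ℕ
  | skip => []
  | assign _ _ => []
  | store a _ _ => [a]
  | seq p q => p.arrs ++ q.arrs
  | ite _ p q => p.arrs ++ q.arrs
  | rep _ _ p => p.arrs

/-- The states `s` and `s'` agree outside the memory written to by `p`. -/
def Agree (p : LoopProgram) (s s' : State) : Prop :=
  (∀ x, x ∉ p.regs → s'.reg x = s.reg x) ∧ ∀ a, a ∉ p.arrs → s'.arr a = s.arr a

theorem Agree.trans {p : LoopProgram} {s s' s'' : State} (h : p.Agree s s') (h' : p.Agree s' s'') :
    p.Agree s s'' :=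
  ⟨fun x hx => (h'.1 x hx).trans (h.1 x hx), fun a ha => (h'.2 a ha).trans (h.2 a ha)⟩

/-- The frame rule. For a concrete program `regs` and `arrs` are explicit lists, so `decide` settles
that a given register or array survives its execution. -/
theorem exec_agree (p : LoopProgram) (s : State) : p.Agree s (p.exec s) := by
  induction p generalizing s with
  | skip => exact ⟨fun _ _ => rfl, fun _ _ => rfl⟩
  | assign x e =>
    refine ⟨fun y hy => ?_, fun _ _ => rfl⟩
    simp only [regs, List.mem_singleton] at hy
    simp [exec, hy]
  | store a i e =>
    refine ⟨fun _ _ => rfl, fun b hb => ?_⟩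
    simp only [arrs, List.mem_singleton] at hb
    simp [exec, State.setArr_arr_of_ne, hb]
  | seq p q hp hq =>
    refine ⟨fun x hx => ?_, fun a ha => ?_⟩
    · simp only [regs, List.mem_append, not_or] at hx
      exact ((hq _).1 x hx.2).trans ((hp _).1 x hx.1)
    · simp only [arrs, List.mem_append, not_or] at ha
      exact ((hq _).2 a ha.2).trans ((hp _).2 a ha.1)
  | ite e p q hp hq =>
    refine ⟨fun x hx => ?_, fun a ha => ?_⟩
    · simp only [regs, List.mem_append, not_or] at hx
      simp only [exec]
      split_ifs
      exacts [(hp _).1 x hx.1, (hq _).1 x hx.2]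
    · simp only [arrs, List.mem_append, not_or] at ha
      simp only [exec]
      split_ifs
      exacts [(hp _).2 a ha.1, (hq _).2 a ha.2]
  | rep i y p hp =>
    simp only [exec]
    generalize s.reg y = m
    induction m with
    | zero =>
      refine ⟨fun x hx => ?_, fun _ _ => rfl⟩
      simp only [regs, List.mem_cons, not_or] at hx
      simp [hx.1]
    | succ m ih =>
      rw [Function.iterate_succ_apply']
      refine ih.trans ⟨fun x hx => ?_, fun a ha => ?_⟩
      · simp only [regs, List.mem_cons, not_or] at hx
        simp [hx.1, (hp _).1 x hx.2]
      · exact (hp _).2 a ha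

theorem exec_reg {p : LoopProgram} {x : ℕ} (h : x ∉ p.regs) (s : State) :
    (p.exec s).reg x = s.reg x :=
  (p.exec_agree s).1 x h

theorem exec_arr {p : LoopProgram} {a : ℕ} (h : a ∉ p.arrs) (s : State) :
    (p.exec s).arr a = s.arr a :=
  (p.exec_agree s).2 a h

/-- Reasoning about counting loops by invariants. -/
theorem rep_induct {i y : ℕ} {p : LoopProgram} {s : State} (Inv : ℕ → State → Prop)
    (hi : i ∉ p.regs) (zero : Inv 0 (s.setReg i 0))
    (succ : ∀ m s', m < s.reg y → (rep i y p).Agree s s' → s'.reg i = m → Inv m s' →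
      Inv (m + 1) ((p.exec s').setReg i (m + 1))) :
    Inv (s.reg y) ((rep i y p).exec s) := by
  simp only [exec]
  suffices h : ∀ m ≤ s.reg y, ∀ s', s' =
      (fun s' => (p.exec s').setReg i ((p.exec s').reg i + 1))^[m] (s.setReg i 0) →
      Inv m s' ∧ s'.reg i = m ∧ (rep i y p).Agree s s' from (h _ le_rfl _ rfl).1
  intro m
  induction m with
  | zero =>
    rintro - s' rfl
    refine ⟨zero, by simp, fun x hx => ?_, fun _ _ => rfl⟩
    simp only [regs, List.mem_cons, not_or] at hx
    simp [hx.1]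
  | succ m ih =>
    rintro hm s' rfl
    obtain ⟨h1, h2, h3⟩ := ih (by omega) _ rfl
    rw [Function.iterate_succ_apply']
    generalize (fun s' => (p.exec s').setReg i ((p.exec s').reg i + 1))^[m] (s.setReg i 0) = s'
      at h1 h2 h3
    have h4 : (p.exec s').reg i = m := by rw [exec_reg hi, h2]
    simp only [h4]
    refine ⟨succ m s' (by omega) h3 h2 h1, by simp, h3.trans ⟨fun x hx => ?_, fun a ha => ?_⟩⟩
    · simp only [regs, List.mem_cons, not_or] at hx
      simp [hx.1, exec_reg hx.2]
    · exact exec_arr (p := p) ha s'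

/-- A loop that sets register `e` to `0` unless `P` holds for all values of the loop counter. -/
theorem rep_flag {i y e : ℕ} {p : LoopProgram} {s : State} (P : ℕ → Prop) [DecidablePred P]
    (hi : i ∉ p.regs) (he : e ≠ i)
    (h : ∀ m s', m < s.reg y → (rep i y p).Agree s s' → s'.reg i = m →
      (p.exec s').reg e = if P m then s'.reg e else 0) :
    ((rep i y p).exec s).reg e = if ∀ m < s.reg y, P m then s.reg e else 0 := by
  refine rep_induct (fun l s' => s'.reg e = if ∀ m < l, P m then s.reg e else 0) hi (by simp [he])
    fun m s' hm ha hs' ih => ?_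
  simp only [State.setReg_reg, he, if_false, h m s' hm ha hs', ih]
  by_cases h1 : P m <;> by_cases h2 : ∀ l < m, P l
  · have : ∀ l < m + 1, P l := fun l hl => (Nat.lt_succ_iff_lt_or_eq.1 hl).elim (h2 l) (· ▸ h1)
    rw [if_pos h1, if_pos h2, if_pos this]
  · have : ¬ ∀ l < m + 1, P l := fun h3 => h2 fun l hl => h3 l (by omega)
    simp only [h2, this, if_false, ite_self]
  · have : ¬ ∀ l < m + 1, P l := fun h3 => h1 (h3 m (by omega))
    simp only [h1, this, if_false]
  · have : ¬ ∀ l < m + 1, P l := fun h3 => h1 (h3 m (by omega))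
    simp only [h1, this, if_false]

/-- The bounds of all loops are in registers from `Y`, these are never written to, and loop
counters are only changed by their loops. -/
def WellFormed (Y : List ℕ) : LoopProgram → Bool
  | skip => true
  | assign x _ => decide (x ∉ Y)
  | store _ _ _ => true
  | seq p q => p.WellFormed Y && q.WellFormed Y
  | ite _ p q => p.WellFormed Y && q.WellFormed Y
  | rep i y p => decide (y ∈ Y) && decide (i ∉ Y) && decide (i ∉ p.regs) && p.WellFormed Y

/-! ### Running time of programs with bounded loops -/

theorem notMem_regs_of_wellFormed {Y : List ℕ} {p : LoopProgram} (h : p.WellFormed Y) {y : ℕ}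
    (hy : y ∈ Y) : y ∉ p.regs := by
  induction p with
  | skip => simp [regs]
  | assign x e =>
    simp only [WellFormed, decide_eq_true_eq] at h
    simp only [regs, List.mem_singleton]
    rintro rfl
    exact h hy
  | store a i e => simp [regs]
  | seq p q hp hq =>
    simp only [WellFormed, Bool.and_eq_true] at h
    simp [regs, hp h.1, hq h.2]
  | ite e p q hp hq =>
    simp only [WellFormed, Bool.and_eq_true] at h
    simp [regs, hp h.1, hq h.2]
  | rep i z p hp =>
    simp only [WellFormed, Bool.and_eq_true, decide_eq_true_eq] at h
    simp only [regs, List.mem_cons, not_or]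
    refine ⟨?_, hp h.2⟩
    rintro rfl
    exact h.1.1.2 hy

/-- A bound for the running time if all loop bounds are at most `m`. -/
def time (m : ℕ) : LoopProgram → ℕ
  | skip => 1
  | assign _ e => e.cost + 1
  | store _ i e => i.cost + e.cost + 1
  | seq p q => p.time m + q.time m
  | ite e p q => e.cost + 1 + (p.time m + q.time m)
  | rep _ _ p => 6 + m * (p.time m + 8)

/-- The body changes neither the bound `y` nor the counter `i`. So `y - i` is the number of
remaining rounds, and the compiled while loop makes exactly as many rounds as `exec` prescribes. -/
theorem exists_run {Y : List ℕ} {m : ℕ} {p : LoopProgram} (h : p.WellFormed Y) {s : State}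
    (hs : ∀ y ∈ Y, s.reg y ≤ m) : ∃ t ≤ p.time m, Run p.compile s t (p.exec s) := by
  induction p generalizing s with
  | skip => exact ⟨_, le_rfl, .skip _⟩
  | assign x e => exact ⟨_, le_rfl, .assign _ _ _⟩
  | store a i e => exact ⟨_, le_rfl, .store _ _ _ _⟩
  | seq p q hp hq =>
    simp only [WellFormed, Bool.and_eq_true] at h
    obtain ⟨t, ht, hr⟩ := hp h.1 hs
    obtain ⟨t', ht', hr'⟩ := hq h.2 (s := p.exec s) fun y hy => by
      rw [exec_reg (notMem_regs_of_wellFormed h.1 hy)]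
      exact hs y hy
    exact ⟨t + t', by simp only [time]; omega, .seq hr hr'⟩
  | ite e p q hp hq =>
    simp only [WellFormed, Bool.and_eq_true] at h
    by_cases he : e.eval s = 0
    · obtain ⟨t, ht, hr⟩ := hq h.2 hs
      refine ⟨e.cost + 1 + t, by simp only [time]; omega, ?_⟩
      rw [exec, if_neg (not_not.2 he)]
      exact .ite_false he hr
    · obtain ⟨t, ht, hr⟩ := hp h.1 hs
      refine ⟨e.cost + 1 + t, by simp only [time]; omega, ?_⟩
      rw [exec, if_pos he]
      exact .ite_true he hr
  | rep i y p hp =>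
    simp only [WellFormed, Bool.and_eq_true, decide_eq_true_eq] at h
    obtain ⟨⟨⟨hy, hiY⟩, hi⟩, hw⟩ := h
    have hne : y ≠ i := fun e => hiY (e ▸ hy)
    -- A test costs 4 and an increment of the counter 4, hence 8 per round besides the body. The
    -- last, failing test costs 4 and the initial assignment 2, hence the 6 in `time`.
    have key : ∀ l s', s'.reg i + l = s'.reg y → (∀ y ∈ Y, s'.reg y ≤ m) →
        ∃ t ≤ 4 + l * (p.time m + 8), Run (.loop (.sub (.reg y) (.reg i))
          (.seq p.compile (.assign i (.add (.reg i) (.const 1))))) s' t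
          ((fun s' => (p.exec s').setReg i ((p.exec s').reg i + 1))^[l] s') := by
      intro l
      induction l with
      | zero =>
        intro s' h1 h2
        exact ⟨_, by simp [Expr.cost], .loop_false (by simp; omega)⟩
      | succ l ih =>
        intro s' h1 h2
        obtain ⟨t, ht, hr⟩ := hp hw h2
        have hpi : (p.exec s').reg i = s'.reg i := exec_reg hi _
        have hpY : ∀ z ∈ Y, (p.exec s').reg z = s'.reg z := fun z hz =>
          exec_reg (notMem_regs_of_wellFormed hw hz) _
        obtain ⟨t', ht', hr'⟩ := ih ((p.exec s').setReg i ((p.exec s').reg i + 1))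
          (by simp [hne, hpi, hpY y hy]; omega) fun z hz => by
            have : z ≠ i := fun e => hiY (e ▸ hz)
            simpa [this, hpY z hz] using h2 z hz
        refine ⟨_, ?_, .loop_true (by simp; omega) (.seq hr (.assign _ _ _)) hr'⟩
        simp only [Expr.cost]
        rw [Nat.succ_mul]
        omega
    obtain ⟨t, ht, hr⟩ := key (s.reg y) (s.setReg i 0) (by simp [hne]) fun z hz => by
      have : z ≠ i := fun e => hiY (e ▸ hz)
      simpa [this] using hs z hz
    refine ⟨2 + t, ?_, .seq (.assign _ _ _) hr⟩
    have := Nat.mul_le_mul_right (p.time m + 8) (hs y hy)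
    simp only [time]
    omega

theorem exists_time_le (p : LoopProgram) : ∃ A d : ℕ, ∀ m, p.time m ≤ A * (m + 1) ^ d := by
  induction p with
  | skip => exact ⟨1, 0, fun m => by simp [time]⟩
  | assign x e => exact ⟨e.cost + 1, 0, fun m => by simp [time]⟩
  | store a i e => exact ⟨i.cost + e.cost + 1, 0, fun m => by simp [time]⟩
  | seq p q hp hq =>
    obtain ⟨A, d, h⟩ := hp
    obtain ⟨A', d', h'⟩ := hq
    refine ⟨A + A', d + d', fun m => ?_⟩
    rw [time, add_mul]
    exact add_le_add
      ((h m).trans (Nat.mul_le_mul_left _ (Nat.pow_le_pow_right (by omega) (by omega))))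
      ((h' m).trans (Nat.mul_le_mul_left _ (Nat.pow_le_pow_right (by omega) (by omega))))
  | ite e p q hp hq =>
    obtain ⟨A, d, h⟩ := hp
    obtain ⟨A', d', h'⟩ := hq
    refine ⟨e.cost + 1 + (A + A'), d + d', fun m => ?_⟩
    rw [time, add_mul, add_mul A]
    exact add_le_add (Nat.le_mul_of_pos_right _ (by positivity)) <|
      add_le_add ((h m).trans (Nat.mul_le_mul_left _ (Nat.pow_le_pow_right (by omega) (by omega))))
        ((h' m).trans (Nat.mul_le_mul_left _ (Nat.pow_le_pow_right (by omega) (by omega))))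
  | rep i y p hp =>
    obtain ⟨A, d, h⟩ := hp
    -- The 14 absorbs the constants 6 and 8 of the loop; each level of nesting raises the degree by
    -- one.
    refine ⟨A + 14, d + 1, fun m => ?_⟩
    have h1 : 1 ≤ (m + 1) ^ d := Nat.one_le_pow _ _ (by omega)
    have h2 := h m
    rw [time, pow_succ]
    nlinarith [Nat.mul_le_mul_left m h2, Nat.mul_le_mul_left m h1]

end LoopProgram

end RAM

/-! ### Reconfiguration by recoloring classes of twins -/

namespace ListColoring

variable {V C : Type*} {G : SimpleGraph V} {L : V → Finset C}

/-- There is a reconfiguration sequence of length `ℓ` between `f` and `g`. -/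
def Reaches (L : V → Finset C) (f g : G.Coloring C) (ℓ : ℕ) : Prop :=
  ∃ s, IsReconfSeq L f g ℓ s

theorem Reaches.refl {f : G.Coloring C} (hf : IsListColoring L f) : Reaches L f f 0 :=
  ⟨fun _ => f, rfl, rfl, fun _ => hf, fun i => i.elim0⟩

theorem Reaches.snoc {f g h : G.Coloring C} {ℓ : ℕ} (hfg : Reaches L f g ℓ)
    (hh : IsListColoring L h) (hgh : Adjacent g h) : Reaches L f h (ℓ + 1) := by
  obtain ⟨s, h0, h1, h2, h3⟩ := hfg
  refine ⟨Fin.snoc (α := fun _ => G.Coloring C) s h, ?_, by simp, fun i => ?_, fun i => ?_⟩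
  · rw [← Fin.castSucc_zero, Fin.snoc_castSucc, h0]
  · induction i using Fin.lastCases with
    | last => simpa using hh
    | cast i => simpa using h2 i
  · induction i using Fin.lastCases with
    | last => simpa [Fin.succ_last, h1] using hgh
    | cast i =>
      rw [Fin.succ_castSucc, Fin.snoc_castSucc, Fin.snoc_castSucc]
      exact h3 i

theorem Reaches.exists_snoc {f h : G.Coloring C} {ℓ : ℕ} (hfh : Reaches L f h (ℓ + 1)) :
    ∃ g, Reaches L f g ℓ ∧ IsListColoring L h ∧ Adjacent g h := by
  obtain ⟨s, h0, h1, h2, h3⟩ := hfh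
  refine ⟨s (Fin.last ℓ).castSucc, ⟨fun i => s i.castSucc, h0, rfl, fun i => h2 _, fun i => ?_⟩,
    h1 ▸ h2 _, ?_⟩
  · have := h3 i.castSucc
    rwa [Fin.succ_castSucc] at this
  · have := h3 (Fin.last ℓ)
    rwa [Fin.succ_last, h1] at this

theorem Reaches.trans {f g h : G.Coloring C} {ℓ m : ℕ} (hfg : Reaches L f g ℓ)
    (hgh : Reaches L g h m) : Reaches L f h (ℓ + m) := by
  induction m generalizing h with
  | zero =>
    obtain ⟨s, h0, h1, -⟩ := hgh
    obtain rfl : g = h := h0.symm.trans h1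
    exact hfg
  | succ m ih =>
    obtain ⟨g', h1, h2, h3⟩ := hgh.exists_snoc
    exact (ih h1).snoc h2 h3

/-- The vertices of an independent set can be recolored one after the other. -/
theorem reaches_hammingDist [Fintype V] [DecidableEq C] {f g : G.Coloring C}
    (hf : IsListColoring L f) (hg : IsListColoring L g)
    (h : ∀ u v, f u ≠ g u → f v ≠ g v → ¬ G.Adj u v) : Reaches L f g (hammingDist f g) := by
  classical
  induction hd : hammingDist (f : V → C) g generalizing f with
  | zero =>
    obtain rfl : f = g := RelHom.ext fun v => congrFun (hammingDist_eq_zero.1 hd) v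
    exact .refl hf
  | succ d ih =>
    obtain ⟨x, hx⟩ : ∃ x, f x ≠ g x := by
      by_contra! hc
      rw [hammingDist_eq_zero.2 (funext hc)] at hd
      omega
    -- Giving `x` its final color is legal: by `h` no neighbor of `x` still has to change, so the
    -- neighbors already have their colors under the proper coloring `g`.
    have hval : ∀ u v, G.Adj u v →
        Function.update (f : V → C) x (g x) u ≠ Function.update (f : V → C) x (g x) v := by
      intro u v huv
      have key : ∀ w, G.Adj x w → g x ≠ f w := fun w hw => by
        have : f w = g w := by
          by_contra hc
          exact h x w hx hc hw
        rw [this]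
        exact g.valid hw
      rcases eq_or_ne u x with rfl | hu
      · have : v ≠ u := huv.ne'
        simpa [this] using key v huv
      rcases eq_or_ne v x with rfl | hv
      · simpa [hu] using (key u huv.symm).symm
      simpa [hu, hv] using f.valid huv
    let f' : G.Coloring C := .mk (Function.update (f : V → C) x (g x)) fun {u v} => hval u v
    have hf' : ∀ v, f' v = if v = x then g x else f v := fun v => by
      change Function.update (f : V → C) x (g x) v = _
      rw [Function.update_apply]
    have hset : ({v | f' v ≠ g v} : Finset V) = ({v | f v ≠ g v} : Finset V).erase x := by
      ext v
      by_cases hv : v = x <;> simp [hf', hv]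
    have hd' : hammingDist (f' : V → C) g = d := by
      have h1 : hammingDist (f' : V → C) g = (({v | f v ≠ g v} : Finset V).erase x).card := by
        rw [← hset]; rfl
      have h2 : ({v | f v ≠ g v} : Finset V).card = d + 1 := hd
      rw [h1, Finset.card_erase_of_mem (by simpa using hx), h2]
      rfl
    have hlist : IsListColoring L f' := fun v => by
      rw [hf']
      split_ifs with hv
      exacts [hv ▸ hg x, hf v]
    have hadj : Adjacent f f' := by
      refine Set.ncard_eq_one.2 ⟨x, ?_⟩
      ext v
      by_cases hv : v = x
      · simp [hf', hv, hx]
      · simp [hf', hv]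
    have := ((Reaches.refl hf).snoc hlist hadj).trans (ih hlist (fun u v hu hv => ?_) hd')
    · rwa [Nat.zero_add, add_comm] at this
    · have aux : ∀ w, f' w ≠ g w → f w ≠ g w := fun w hw => by
        rw [hf'] at hw
        split_ifs at hw with hwx
        · exact absurd (congrArg g hwx.symm) hw
        · exact hw
      exact h u v (aux u hu) (aux v hv)

end ListColoring

/-! ### Twin classes and class moves -/

namespace ReconfInstance

open ListColoring

variable (I : ReconfInstance)

/-- Two vertices are twins if they cannot be distinguished by their neighborhoods, their lists and
their initial and target colors. -/
def Twins (u v : Fin I.n) : Prop :=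
  (∀ w, I.graph.Adj u w ↔ I.graph.Adj v w) ∧ I.lists u = I.lists v ∧ I.ini u = I.ini v ∧
    I.tar u = I.tar v

/-- The function `cls` numbers the classes of twins by `0, …, r - 1`. -/
structure IsClassification (cls : ℕ → ℕ) (r : ℕ) : Prop where
  eq_iff : ∀ u v : Fin I.n, cls u = cls v ↔ I.Twins u v
  lt : ∀ v : Fin I.n, cls v < r
  surj : ∀ j < r, ∃ v : Fin I.n, cls v = j

/-- A bound on the number of classes of twins of split graphs with `k` colors. -/
def classBound (k : ℕ) : ℕ := k + 2 ^ k * (2 ^ k * (k * k))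

variable {I} {cls : ℕ → ℕ} {r b : ℕ}

/-- Each end of an edge may be exchanged for a twin, one end at a time. -/
theorem IsClassification.adj (h : I.IsClassification cls r) {u v u' v' : Fin I.n}
    (hu : cls u = cls u') (hv : cls v = cls v') (huv : I.graph.Adj u v) : I.graph.Adj u' v' := by
  have h1 := (((h.eq_iff u u').1 hu).1 v).1 huv
  exact ((((h.eq_iff v v').1 hv).1 u').1 h1.symm).symm

/-- Replacing one end of an edge between twins by the other would give a loop. -/
theorem IsClassification.not_adj (h : I.IsClassification cls r) {u v : Fin I.n}
    (huv : cls u = cls v) : ¬ I.graph.Adj u v := fun ha =>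
  I.graph.irrefl (h.adj huv rfl ha)

theorem IsClassification.exists_rep (h : I.IsClassification cls r) :
    ∃ rep : Fin r → Fin I.n, ∀ j, cls (rep j) = j := by
  choose rep hrep using h.surj
  exact ⟨fun j => rep j j.2, fun j => hrep j j.2⟩

theorem IsClassification.le_classBound (h : I.IsClassification cls r) (hI : I.graph.IsSplitGraph) :
    r ≤ classBound I.k := by
  classical
  obtain ⟨K, hK, hK'⟩ := hI
  obtain ⟨rep, hrep⟩ := h.exists_rep
  have hinj : ∀ u ∈ K, ∀ v ∈ K, I.ini u = I.ini v → u = v := fun u hu v hv huv => by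
    by_contra hne
    exact I.ini.valid (hK hu hv hne) huv
  -- A key that separates non-twins. Outside `K` all neighbors lie in `K`, where `ini` is injective,
  -- so the set of their initial colors recovers the neighborhood. The codomain has `classBound I.k`
  -- elements.
  let Φ : Fin I.n → Fin I.k ⊕ (Finset (Fin I.k) × Finset (Fin I.k) × Fin I.k × Fin I.k) := fun v =>
    if v ∈ K then .inl (I.ini v)
    else .inr (({w | I.graph.Adj v w} : Finset (Fin I.n)).image I.ini, I.lists v, I.ini v, I.tar v)
  have hN : ∀ u ∉ K, ∀ w, I.graph.Adj u w → w ∈ K := fun u hu w huw => by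
    by_contra hw
    exact hK' hu hw huw.ne huw
  have aux : ∀ u v, u ∉ K → v ∉ K → ({w | I.graph.Adj u w} : Finset (Fin I.n)).image I.ini =
      ({w | I.graph.Adj v w} : Finset (Fin I.n)).image I.ini →
      ∀ w, I.graph.Adj u w → I.graph.Adj v w := fun u v hu hv he w huw => by
    have : I.ini w ∈ ({w | I.graph.Adj v w} : Finset (Fin I.n)).image I.ini := by
      rw [← he]
      exact Finset.mem_image_of_mem _ (by simpa using huw)
    obtain ⟨w', hw', heq⟩ := Finset.mem_image.1 this
    simp only [Finset.mem_filter, Finset.mem_univ, true_and] at hw'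
    rwa [← hinj w' (hN v hv _ hw') w (hN u hu _ huw) heq]
  have hΦ : ∀ u v, Φ u = Φ v → I.Twins u v := fun u v huv => by
    by_cases hu : u ∈ K <;> by_cases hv : v ∈ K <;>
      simp only [Φ, hu, hv, if_true, if_false, Sum.inl.injEq, Sum.inr.injEq, Prod.mk.injEq,
        reduceCtorEq] at huv
    · obtain rfl := hinj u hu v hv huv
      exact ⟨fun _ => .rfl, rfl, rfl, rfl⟩
    · exact ⟨fun w => ⟨aux u v hu hv huv.1 w, aux v u hv hu huv.1.symm w⟩, huv.2⟩
  have hcard := Fintype.card_le_of_injective (fun j : Fin r => Φ (rep j)) fun i j hij => by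
    have := (h.eq_iff _ _).2 (hΦ _ _ hij)
    rw [hrep i, hrep j] at this
    exact Fin.ext this
  simpa [classBound] using hcard

/-- The color assignment `cur` is the `L`-coloring `f`. -/
def Represents (cur : ℕ → ℕ) (f : I.graph.Coloring (Fin I.k)) : Prop :=
  IsListColoring I.lists f ∧ ∀ v : Fin I.n, cur v = f v

/-- The state of the simulation of a sequence of moves: the moves left, the number of vertices
recolored so far, a flag that is `0` after an illegal move, and the current color assignment. -/
structure Simulation where
  code : ℕ
  cost : ℕ
  ok : ℕ
  cur : ℕ → ℕ

open Classical in
/-- The simulation of a move. The two lowest digits of the code with respect to base `b` are the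
class to be recolored and its new color. -/
noncomputable def step (I : ReconfInstance) (cls : ℕ → ℕ) (b : ℕ) (s : Simulation) :
    Simulation where
  code := s.code / b / b
  cost := s.cost + ((Finset.range I.n).filter
    fun v => cls v = s.code % b ∧ s.cur v ≠ s.code / b % b).card
  ok := if ∃ f : I.graph.Coloring (Fin I.k), Represents
    (fun v => if v < I.n ∧ cls v = s.code % b then s.code / b % b else s.cur v) f then s.ok else 0
  cur := fun v => if v < I.n ∧ cls v = s.code % b then s.code / b % b else s.cur v

/-! ### Simulated moves against reconfiguration sequences and walks -/

theorem step_cost {s : Simulation} {f g : I.graph.Coloring (Fin I.k)} (hf : Represents s.cur f)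
    (hg : Represents (step I cls b s).cur g) :
    (step I cls b s).cost = s.cost + hammingDist (f : Fin I.n → Fin I.k) g := by
  have hg2 : ∀ v : Fin I.n, (if cls v = s.code % b then s.code / b % b else s.cur v) = g v :=
    fun v => by
      have := hg.2 v
      simpa [step] using this
  simp only [step, add_right_inj, hammingDist]
  symm
  refine Finset.card_bij (fun v _ => (v : ℕ)) (fun v hv => ?_) (fun u _ v _ h => Fin.ext h)
    fun v hv => ?_
  · simp only [Finset.mem_filter, Finset.mem_univ, true_and, ne_eq, Fin.ext_iff, ← hg2] at hv
    rw [← hf.2] at hv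
    simp only [Finset.mem_filter, Finset.mem_range, v.2, true_and]
    split_ifs at hv with h
    · exact ⟨h, hv⟩
    · exact absurd rfl hv
  · simp only [Finset.mem_filter, Finset.mem_range] at hv
    refine ⟨⟨v, hv.1⟩, ?_, rfl⟩
    simp only [Finset.mem_filter, Finset.mem_univ, true_and, ne_eq, Fin.ext_iff, ← hg2]
    rw [← hf.2, if_pos hv.2.1]
    exact hv.2.2

/-- A cleared flag is never raised again, so a final success certifies every intermediate coloring.
-/
theorem ok_of_iterate_step {m : ℕ} {s : Simulation} (h : ((step I cls b)^[m] s).ok ≠ 0) :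
    s.ok ≠ 0 := by
  induction m generalizing s with
  | zero => exact h
  | succ m ih =>
    have := ih (s := step I cls b s) h
    simp only [step] at this
    split_ifs at this with hc
    · exact this
    · exact absurd rfl this

/-- Soundness of the simulation: a legal move changes vertices of one class only. The class is
independent, so the move splits into as many single recolorings as the simulation counts. -/
theorem reaches_of_iterate_step (hc : I.IsClassification cls r) {m : ℕ} {s : Simulation}
    {f g : I.graph.Coloring (Fin I.k)} (hf : Represents s.cur f)
    (hok : ((step I cls b)^[m] s).ok ≠ 0) (hg : ∀ v : Fin I.n, ((step I cls b)^[m] s).cur v = g v) :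
    ∃ ℓ, ((step I cls b)^[m] s).cost = s.cost + ℓ ∧ Reaches I.lists f g ℓ := by
  induction m generalizing s f with
  | zero =>
    refine ⟨0, rfl, ?_⟩
    obtain rfl : f = g := RelHom.ext fun v => Fin.ext ((hf.2 v).symm.trans (hg v))
    exact .refl hf.1
  | succ m ih =>
    rw [Function.iterate_succ_apply] at hok hg ⊢
    obtain ⟨h, hh⟩ : ∃ h, Represents (step I cls b s).cur h := by
      by_contra hc
      have : (step I cls b s).ok = 0 := if_neg hc
      exact ok_of_iterate_step hok this
    obtain ⟨ℓ, h1, h2⟩ := ih hh hok hg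
    refine ⟨hammingDist (f : Fin I.n → Fin I.k) h + ℓ, ?_, .trans ?_ h2⟩
    · rw [h1, step_cost hf hh, add_assoc]
    · have key : ∀ v : Fin I.n, f v ≠ h v → cls v = s.code % b := fun v hv => by
        by_contra hne
        refine hv (Fin.ext ?_)
        rw [← hf.2, ← hh.2]
        simp [step, hne]
      exact reaches_hammingDist hf.1 hh.1 fun u v hu hv =>
        hc.not_adj ((key u hu).trans (key v hv).symm)

/-- The `L`-colorings that are constant on each class of twins. -/
abbrev UniformColoring (I : ReconfInstance) (cls : ℕ → ℕ) :=
  {f : I.graph.Coloring (Fin I.k) //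
    IsListColoring I.lists f ∧ ∀ u v : Fin I.n, cls u = cls v → f u = f v}

/-- The values on one representative of each class determine the coloring; this bounds the number of
such colorings by `k ^ r`. -/
theorem UniformColoring.injective (hc : I.IsClassification cls r) :
    ∃ F : UniformColoring I cls → (Fin r → Fin I.k), Function.Injective F := by
  obtain ⟨rep, hrep⟩ := hc.exists_rep
  refine ⟨fun f j => f.1 (rep j), fun f g hfg => Subtype.ext (RelHom.ext fun v => ?_)⟩
  have hv := hrep ⟨cls v, hc.lt v⟩
  have := congrFun hfg ⟨cls v, hc.lt v⟩
  simpa only [f.2.2 _ _ hv, g.2.2 _ _ hv] using this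

/-- Two colorings are joined by an edge if they differ on one class of twins. -/
def moveGraph (I : ReconfInstance) (cls : ℕ → ℕ) : SimpleGraph (UniformColoring I cls) where
  Adj f g := f ≠ g ∧ ∃ j, ∀ v : Fin I.n, cls v ≠ j → f.1 v = g.1 v
  symm := ⟨fun _ _ h => ⟨h.1.symm, h.2.imp fun _ hj v hv => (hj v hv).symm⟩⟩
  loopless := ⟨fun _ h => h.1 rfl⟩

/-- The number of single vertex recolorings needed for a walk in the graph of moves. -/
def walkCost {f g : UniformColoring I cls} (p : (moveGraph I cls).Walk f g) : ℕ :=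
  (p.darts.map fun d => hammingDist (d.fst.1 : Fin I.n → Fin I.k) d.snd.1).sum

/-- Completeness of the simulation. The code is built from the last move backwards, each new move
becoming the two lowest digits. The strict inequality `r < b` makes the unused class number `r`
available as a digit. -/
theorem exists_code_of_walk (hc : I.IsClassification cls r) (hr : r < b) (hk : I.k ≤ b)
    {f g : UniformColoring I cls} (p : (moveGraph I cls).Walk f g) {m : ℕ} (hm : p.length ≤ m) :
    ∃ N < (b * b) ^ m, ∀ s : Simulation, s.code = N → Represents s.cur f.1 → s.ok ≠ 0 →
      ((step I cls b)^[m] s).ok ≠ 0 ∧ Represents ((step I cls b)^[m] s).cur g.1 ∧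
      ((step I cls b)^[m] s).cost = s.cost + walkCost p := by
  have hb : 0 < b := by omega
  have hcode : ∀ j c N m : ℕ, j < b → c < b → N < (b * b) ^ m →
      j + b * (c + b * N) < (b * b) ^ (m + 1) ∧ (j + b * (c + b * N)) % b = j ∧
      (j + b * (c + b * N)) / b % b = c ∧ (j + b * (c + b * N)) / b / b = N := by
    intro j c N m hj hc hN
    have h1 : (j + b * (c + b * N)) / b = c + b * N := by
      rw [Nat.add_mul_div_left _ _ hb, Nat.div_eq_of_lt hj, Nat.zero_add]
    refine ⟨?_, by rw [Nat.add_mul_mod_self_left, Nat.mod_eq_of_lt hj], ?_, ?_⟩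
    · have h2 : c + b * N < b * (N + 1) := by rw [mul_add]; omega
      have h3 : j + b * (c + b * N) < b * (c + b * N + 1) := by rw [mul_add b (c + b * N)]; omega
      refine h3.trans_le ((Nat.mul_le_mul_left b h2).trans ?_)
      rw [← mul_assoc, pow_succ, mul_comm]
      exact Nat.mul_le_mul_right _ hN
    · rw [h1, Nat.add_mul_mod_self_left, Nat.mod_eq_of_lt hc]
    · rw [h1, Nat.add_mul_div_left _ _ hb, Nat.div_eq_of_lt hc, Nat.zero_add]
  induction p generalizing m with
  | nil =>
    rename_i f
    induction m with
    | zero => exact ⟨0, by simp, fun s _ h1 h2 => ⟨h2, h1, by simp [walkCost]⟩⟩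
    | succ m ih =>
      obtain ⟨N, hN, h⟩ := ih (by simp)
      -- No vertex has class `r`, so this move is idle; it pads short walks to exactly `m` moves.
      obtain ⟨h1, h2, h3, h4⟩ := hcode r 0 N m hr hb hN
      refine ⟨_, h1, fun s hs hf hok => ?_⟩
      have hrep : Represents (step I cls b s).cur f.1 := by
        refine ⟨hf.1, fun v => ?_⟩
        simp only [step, hs, h2, v.2, true_and]
        rw [if_neg (hc.lt v).ne, hf.2]
      rw [Function.iterate_succ_apply]
      have hok' : (step I cls b s).ok = s.ok := if_pos ⟨_, hrep⟩
      obtain ⟨h5, h6, h7⟩ := h (step I cls b s) (by simp only [step]; rw [hs, h4]) hrep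
        (hok' ▸ hok)
      refine ⟨h5, h6, ?_⟩
      rw [h7, step_cost hf hrep, hammingDist_self]
      rfl
  | cons hadj p ih =>
    rename_i f g h
    obtain _ | m := m
    · simp at hm
    simp only [SimpleGraph.Walk.length_cons, Nat.add_le_add_iff_right] at hm
    obtain ⟨N, hN, hsim⟩ := ih hm
    obtain ⟨hne, j, hj⟩ := hadj
    obtain ⟨x, hx⟩ : ∃ x, f.1 x ≠ g.1 x := by
      by_contra! hcon
      exact hne (Subtype.ext (RelHom.ext hcon))
    obtain rfl : cls x = j := by
      by_contra hcon
      exact hx (hj x hcon)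
    obtain ⟨h1, h2, h3, h4⟩ := hcode (cls x) (g.1 x) N m ((hc.lt x).trans hr)
      ((g.1 x).2.trans_le hk) hN
    refine ⟨_, h1, fun s hs hf hok => ?_⟩
    have hrep : Represents (step I cls b s).cur g.1 := by
      refine ⟨g.2.1, fun v => ?_⟩
      simp only [step, hs, h2, h3, v.2, true_and]
      split_ifs with hv
      · rw [g.2.2 _ _ hv]
      · rw [← hj v hv, hf.2]
    rw [Function.iterate_succ_apply]
    have hok' : (step I cls b s).ok = s.ok := if_pos ⟨_, hrep⟩
    obtain ⟨h5, h6, h7⟩ := hsim (step I cls b s) (by simp only [step]; rw [hs, h4]) hrep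
      (hok' ▸ hok)
    refine ⟨h5, h6, ?_⟩
    rw [h7, step_cost hf hrep, add_assoc]
    rfl

/-- Letting every vertex behave like the twin that is recolored least often turns a
reconfiguration sequence into a walk in the graph of moves that is not more expensive. -/
theorem exists_walk (hc : I.IsClassification cls r) {f g : UniformColoring I cls} {ℓ : ℕ}
    (h : Reaches I.lists f.1 g.1 ℓ) : ∃ p : (moveGraph I cls).Walk f g, walkCost p ≤ ℓ := by
  classical
  obtain ⟨s, h0, h1, h2, h3⟩ := h
  -- The number of times that a vertex is recolored in the sequence `s`.
  let ch : Fin I.n → ℕ := fun v =>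
    ∑ i : Fin ℓ, if s i.castSucc v ≠ s i.succ v then 1 else 0
  have hex : ∀ v : Fin I.n, ∃ u : Fin I.n, cls u = cls v ∧
      ∀ w : Fin I.n, cls w = cls v → ch u ≤ ch w :=
    fun v => by
      obtain ⟨u, hu, hmin⟩ := Finset.exists_min_image
        ({u | cls u = cls v} : Finset (Fin I.n)) ch ⟨v, by simp⟩
      simp only [Finset.mem_filter, Finset.mem_univ, true_and] at hu hmin
      exact ⟨u, hu, hmin⟩
  choose μ' hμ' using hex
  -- The minimizers `μ'` chosen for two twins may differ. Passing through a representative of the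
  -- class makes the choice constant on classes.
  obtain ⟨μ, hμ, hμc, hμm⟩ : ∃ μ : Fin I.n → Fin I.n, (∀ u v : Fin I.n, cls u = cls v → μ u = μ v) ∧
      (∀ v, cls (μ v) = cls v) ∧ ∀ v, ch (μ v) ≤ ch v := by
    obtain ⟨rep, hrep⟩ := hc.exists_rep
    refine ⟨fun v => μ' (rep ⟨cls v, hc.lt v⟩), fun u v huv => ?_, fun v => ?_, fun v => ?_⟩
    · simp only [huv]
    · rw [(hμ' _).1, hrep]
    · exact (hμ' _).2 v (by rw [hrep])
  let s' : Fin (ℓ + 1) → UniformColoring I cls := fun i =>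
    ⟨.mk (fun v => s i (μ v)) fun {u v} huv =>
      (s i).valid (hc.adj (hμc u).symm (hμc v).symm huv), fun v => by
        have := ((hc.eq_iff _ _).1 (hμc v)).2.1
        change s i (μ v) ∈ I.lists v
        rw [← this]
        exact h2 i _, fun u v huv => by
        change s i (μ u) = s i (μ v)
        rw [hμ u v huv]⟩
  have hs' : ∀ i v, (s' i).1 v = s i (μ v) := fun i v => rfl
  have hs0 : s' 0 = f := Subtype.ext <| RelHom.ext fun v => by
    rw [hs', h0, f.2.2 _ _ (hμc v)]
  have hsl : s' (Fin.last ℓ) = g := Subtype.ext <| RelHom.ext fun v => by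
    rw [hs', h1, g.2.2 _ _ (hμc v)]
  -- The colorings `s'` may repeat: a step recoloring a vertex that nobody copies changes nothing,
  -- and the walk skips it.
  have hwalk : ∀ m (hm : m < ℓ + 1), ∃ p : (moveGraph I cls).Walk (s' 0) (s' ⟨m, hm⟩),
      walkCost p ≤ ∑ i : Fin ℓ, if (i : ℕ) < m then
        hammingDist ((s' i.castSucc).1 : Fin I.n → Fin I.k) (s' i.succ).1 else 0 := by
    intro m
    induction m with
    | zero => exact fun _ => ⟨.nil, by simp [walkCost]⟩
    | succ m ih =>
      intro hm
      obtain ⟨p, hp⟩ := ih (by omega)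
      have hsum : (∑ i : Fin ℓ, if (i : ℕ) < m then
          hammingDist ((s' i.castSucc).1 : Fin I.n → Fin I.k) (s' i.succ).1 else 0) +
          hammingDist ((s' ⟨m, by omega⟩).1 : Fin I.n → Fin I.k) (s' ⟨m + 1, hm⟩).1 =
          ∑ i : Fin ℓ, if (i : ℕ) < m + 1 then
          hammingDist ((s' i.castSucc).1 : Fin I.n → Fin I.k) (s' i.succ).1 else 0 := by
        have hsingle := Finset.sum_ite_eq' Finset.univ (⟨m, by omega⟩ : Fin ℓ) fun i =>
          hammingDist ((s' i.castSucc).1 : Fin I.n → Fin I.k) (s' i.succ).1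
        rw [if_pos (Finset.mem_univ _)] at hsingle
        refine (congrArg₂ (· + ·) rfl hsingle.symm).trans ?_
        rw [← Finset.sum_add_distrib]
        refine Finset.sum_congr rfl fun i _ => ?_
        rcases lt_trichotomy (i : ℕ) m with hi | hi | hi
        · rw [if_pos hi, if_neg (fun h => by simp [h] at hi), if_pos (by omega), add_zero]
        · rw [if_neg (by omega), if_pos (Fin.ext hi), if_pos (by omega), zero_add]
        · rw [if_neg (by omega), if_neg (fun h => by simp [h] at hi), if_neg (by omega),
            add_zero]
      rw [← hsum]
      by_cases heq : s' ⟨m, by omega⟩ = s' ⟨m + 1, hm⟩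
      · rw [← heq]
        exact ⟨p, hp.trans (Nat.le_add_right _ _)⟩
      -- Only vertices that copy `x` change, and they all lie in the class of `x`.
      · obtain ⟨x, hx⟩ := Set.ncard_eq_one.1 (h3 ⟨m, by omega⟩)
        have hadj : (moveGraph I cls).Adj (s' ⟨m, by omega⟩) (s' ⟨m + 1, hm⟩) := by
          refine ⟨heq, cls x, fun v hv => ?_⟩
          by_contra hne
          have : μ v ∈ ({x} : Set (Fin I.n)) := by
            rw [← hx]
            exact hne
          rw [Set.mem_singleton_iff] at this
          exact hv (this ▸ (hμc v).symm)
        refine ⟨p.concat hadj, ?_⟩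
        simpa [walkCost, SimpleGraph.Walk.darts_concat] using hp
  obtain ⟨p, hp⟩ := hwalk ℓ (by omega)
  -- Double counting: the cost is at most the sum of `ch (μ v)` over all `v`, hence at most the sum
  -- of `ch v`. The latter is `ℓ`, because every step of `s` recolors exactly one vertex.
  have hle : walkCost p ≤ ℓ := by
    refine hp.trans ?_
    have e1 : ∀ i : Fin ℓ, (if (i : ℕ) < ℓ then
        hammingDist ((s' i.castSucc).1 : Fin I.n → Fin I.k) (s' i.succ).1 else 0) =
        ∑ v : Fin I.n, if s i.castSucc (μ v) ≠ s i.succ (μ v) then 1 else 0 := fun i => by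
      rw [if_pos i.2, hammingDist, Finset.card_filter]
      rfl
    have e2 : ∀ i : Fin ℓ, (∑ v : Fin I.n, if s i.castSucc v ≠ s i.succ v then 1 else 0) = 1 :=
      fun i => by
        rw [← Finset.card_filter, ← h3 i, ← Set.ncard_coe_finset]
        simp
    calc _ = ∑ v : Fin I.n, ch (μ v) := by
            rw [Finset.sum_congr rfl fun i _ => e1 i, Finset.sum_comm]
      _ ≤ ∑ v : Fin I.n, ch v := Finset.sum_le_sum fun v _ => hμm v
      _ = ∑ i : Fin ℓ, 1 := by
            rw [Finset.sum_comm]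
            exact Finset.sum_congr rfl fun i _ => e2 i
      _ = ℓ := by simp
  exact ⟨p.copy hs0 hsl, by simpa [walkCost] using hle⟩

/-- The simulation of the moves encoded by `N` from the initial coloring. -/
noncomputable def simulate (I : ReconfInstance) (cls : ℕ → ℕ) (b m N : ℕ) (cur : ℕ → ℕ) :
    Simulation :=
  (step I cls b)^[m] ⟨N, 0, 1, cur⟩

/-- The simulation of the moves encoded by `N` ends in the target coloring. -/
def Succeeds (I : ReconfInstance) (cls : ℕ → ℕ) (b m N : ℕ) (cur : ℕ → ℕ) : Prop :=
  (simulate I cls b m N cur).ok ≠ 0 ∧ ∀ v : Fin I.n, (simulate I cls b m N cur).cur v = I.tar v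

/-! ### Codes of moves and the optimum -/

theorem opt_le_of_succeeds (hc : I.IsClassification cls r) {m N : ℕ} {cur : ℕ → ℕ}
    (hcur : ∀ v : Fin I.n, cur v = I.ini v) (h : Succeeds I cls b m N cur) :
    I.opt ≤ (simulate I cls b m N cur).cost := by
  obtain ⟨ℓ, h1, h2⟩ := reaches_of_iterate_step hc (s := ⟨N, 0, 1, cur⟩) ⟨I.ini_mem, hcur⟩ h.1 h.2
  rw [simulate, h1, zero_add]
  exact iInf₂_le ℓ h2

/-- Every reconfiguration sequence yields a walk, then a path, then a code below `(b * b) ^ m` of no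
greater cost. The color assignment may depend on `N`, since only its values on the vertices are
controlled. -/
theorem le_opt (hc : I.IsClassification cls r) (hr : r < b) (hk : I.k ≤ b) {m : ℕ}
    (hm : I.k ^ r ≤ m) {c : ℕ∞}
    (h : ∀ N < (b * b) ^ m, ∃ cur : ℕ → ℕ, (∀ v : Fin I.n, cur v = I.ini v) ∧
      (Succeeds I cls b m N cur → c ≤ (simulate I cls b m N cur).cost)) :
    c ≤ I.opt := by
  classical
  refine le_iInf₂ fun ℓ hℓ => ?_
  let f : UniformColoring I cls := ⟨I.ini, I.ini_mem, fun u v huv => ((hc.eq_iff u v).1 huv).2.2.1⟩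
  let g : UniformColoring I cls := ⟨I.tar, I.tar_mem, fun u v huv => ((hc.eq_iff u v).1 huv).2.2.2⟩
  obtain ⟨p, hp⟩ := exists_walk hc (f := f) (g := g) hℓ
  obtain ⟨F, hF⟩ := UniformColoring.injective hc
  have : Fintype (UniformColoring I cls) := Fintype.ofInjective F hF
  -- A path visits each of the at most `k ^ r` uniform colorings at most once.
  have hlen : p.bypass.length ≤ m := by
    have h1 := p.bypass_isPath.length_lt
    have h2 := Fintype.card_le_of_injective F hF
    simp only [Fintype.card_fun, Fintype.card_fin] at h2
    omega
  obtain ⟨N, hN, hsim⟩ := exists_code_of_walk hc hr hk p.bypass hlen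
  obtain ⟨cur, hcur, hle⟩ := h N hN
  obtain ⟨h1, h2, h3⟩ := hsim ⟨N, 0, 1, cur⟩ rfl ⟨I.ini_mem, hcur⟩ (by simp)
  refine (hle ⟨h1, h2.2⟩).trans ?_
  rw [simulate, h3, zero_add]
  have hb : walkCost p.bypass ≤ walkCost p :=
    (p.darts_bypass_sublist_darts.map _).sum_le_sum (by simp)
  exact_mod_cast hb.trans hp

end ReconfInstance

/-! ### The program -/

namespace RAM

namespace LoopProgram

theorem exec_seq (p q : LoopProgram) (s : State) : (seq p q).exec s = q.exec (p.exec s) := rfl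

theorem exec_assign (x : ℕ) (e : Expr) (s : State) :
    (assign x e).exec s = s.setReg x (e.eval s) := rfl

theorem exec_store (a : ℕ) (i e : Expr) (s : State) :
    (store a i e).exec s = s.setArr a (i.eval s) (e.eval s) := rfl

theorem exec_skip (s : State) : skip.exec s = s := rfl

theorem exec_ite_of_ne {e : Expr} {s : State} (h : e.eval s ≠ 0) (p q : LoopProgram) :
    (ite e p q).exec s = p.exec s := if_pos h

theorem exec_ite_of_eq {e : Expr} {s : State} (h : e.eval s = 0) (p q : LoopProgram) :
    (ite e p q).exec s = q.exec s := if_neg (not_not.2 h)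

/-- Nested loops of this kind compute iterated powers without a multiplication instruction. -/
theorem rep_mul {i y x a : ℕ} {p : LoopProgram} {s : State} (hi : i ∉ p.regs) (hx : x ≠ i)
    (h : ∀ s', (rep i y p).Agree s s' → (p.exec s').reg x = a * s'.reg x) :
    ((rep i y p).exec s).reg x = a ^ s.reg y * s.reg x := by
  refine rep_induct (fun m s' => s'.reg x = a ^ m * s.reg x) hi (by simp [hx])
    fun m s' _ ha _ ih => ?_
  simp only [State.setReg_reg, hx, if_false, h s' ha, ih]
  ring

/-- A loop that stores `g i` in cell `i` of array `a` for every value `i` of the loop counter. -/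
theorem rep_store {i y a : ℕ} {p : LoopProgram} {s : State} (g : ℕ → ℕ) (hi : i ∉ p.regs)
    (h : ∀ m s', m < s.reg y → (rep i y p).Agree s s' → s'.reg i = m →
      ∀ j, (p.exec s').arr a j = if j = m then g j else s'.arr a j) (j : ℕ) :
    ((rep i y p).exec s).arr a j = if j < s.reg y then g j else s.arr a j := by
  revert j
  refine rep_induct (fun m s' => ∀ j, s'.arr a j = if j < m then g j else s.arr a j) hi (by simp)
    fun m s' hm ha hs' ih j => ?_
  rw [State.setReg_arr, h m s' hm ha hs', ih]
  by_cases hj : j = m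
  · rw [if_pos hj, if_pos (by omega)]
  · rw [if_neg hj]
    exact if_congr (by omega) rfl rfl

end LoopProgram

/-- An expression that is nonzero if and only if the values of two expressions are different. -/
def Expr.ne (e₁ e₂ : Expr) : Expr := .add (.sub e₁ e₂) (.sub e₂ e₁)

theorem Expr.ne_eval {e₁ e₂ : Expr} {s : State} :
    (Expr.ne e₁ e₂).eval s ≠ 0 ↔ e₁.eval s ≠ e₂.eval s := by
  simp only [Expr.ne, Expr.eval]
  omega

end RAM

namespace ReconfInstance

open RAM ListColoring

/-! The registers of the program are used as follows.

* `0`: whether a sequence of moves to the target coloring has been found, `1`: its cost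
* `2`: the number `n` of vertices, `3`: the number `k` of colors
* `4`, `9`, `10`: vertices or colors
* `5`: a position in the input, `6`, `7`: the positions of the two colorings in the input
* `8`: the number of classes of twins
* `11`: whether two vertices are twins
* `12`: the base `b`, `13`: the number of moves, `14`: the number of sequences of moves
* `15`, `16`, `19`, `25`: loop counters, `17`: the code of a sequence of moves
* `18`: the code of the remaining moves, `20`: a quotient, `21`, `22`: the class and the color of a
  move, `23`: the cost of the moves, `24`: whether they are legal

Array `0` is the input, the arrays `1` and `2` contain the positions of the rows of the adjacency
matrix and of the matrix of the lists, array `3` contains the classes of the vertices and array `4`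
their current colors. -/

def adjExpr (u w : ℕ) : Expr := .read 0 (.add (.read 1 (.reg u)) (.reg w))

def listExpr (u : ℕ) (e : Expr) : Expr := .read 0 (.add (.read 2 (.reg u)) e)

def iniExpr (u : ℕ) : Expr := .read 0 (.add (.reg 6) (.reg u))

def tarExpr (u : ℕ) : Expr := .read 0 (.add (.reg 7) (.reg u))

/-- Reads the number of vertices and the number of colors. -/
def header : LoopProgram :=
  .seq (.assign 2 (.read 0 (.const 0))) <| .seq (.assign 3 (.read 0 (.const 1))) <|
  .seq (.assign 0 (.const 0)) (.assign 5 (.const 2))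

/-- Row offsets are accumulated by addition, which avoids multiplying the row number by the row
length in register `x`. -/
def rowTable (a x : ℕ) : LoopProgram :=
  .rep 4 2 (.seq (.store a (.reg 4) (.reg 5)) (.assign 5 (.add (.reg 5) (.reg x))))

/-- Computes the positions of the parts of the input. -/
def tables : LoopProgram :=
  .seq (rowTable 1 2) <| .seq (rowTable 2 3) <|
  .seq (.assign 6 (.reg 5)) (.assign 7 (.add (.reg 5) (.reg 2)))

def clearIf (x : ℕ) (e : Expr) : LoopProgram := .ite e (.assign x (.const 0)) .skip

def clearUnless (x : ℕ) (e : Expr) : LoopProgram := .ite e .skip (.assign x (.const 0))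

/-- Tests whether the vertices in registers `9` and `4` are twins. -/
def twinTest : LoopProgram :=
  .seq (.assign 11 (.const 1)) <|
  .seq (.rep 10 2 (clearIf 11 (.ne (adjExpr 9 10) (adjExpr 4 10)))) <|
  .seq (.rep 10 3 (clearIf 11 (.ne (listExpr 9 (.reg 10)) (listExpr 4 (.reg 10))))) <|
  .seq (clearIf 11 (.ne (iniExpr 9) (iniExpr 4))) (clearIf 11 (.ne (tarExpr 9) (tarExpr 4)))

/-- Gives the vertex in register `4` the class of a smaller twin if there is one. -/
def findTwin : LoopProgram :=
  .rep 9 2 (.seq twinTest (.ite (.reg 11)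
    (.ite (.sub (.reg 4) (.reg 9)) (.store 3 (.reg 4) (.read 3 (.reg 9))) .skip) .skip))

/-- Numbers the classes of twins. -/
def classify : LoopProgram :=
  .seq (.assign 8 (.const 0)) <|
  .rep 4 2 <| .seq (.store 3 (.reg 4) (.reg 8)) <| .seq findTwin <|
    .ite (.ne (.read 3 (.reg 4)) (.reg 8)) .skip (.assign 8 (.add (.reg 8) (.const 1)))

def double (x : ℕ) : LoopProgram := .assign x (.add (.reg x) (.reg x))

/-- Computes the base and the number of moves of the sequences to be tried. -/
def moveBound : LoopProgram :=
  .seq (.assign 12 (.add (.add (.reg 8) (.reg 3)) (.const 1))) <|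
  .seq (.assign 13 (.const 1)) (.rep 15 3 (.rep 16 8 (double 13)))

/-- Computes the number of sequences of moves to be tried. -/
def codeBound : LoopProgram :=
  .seq (.assign 14 (.const 1)) (.rep 15 12 (.rep 16 13 (.seq (double 14) (double 14))))

/-- Division by repeated subtraction. The test is nonzero exactly when the remainder is still at
least the base. Register 14 bounds the dividend and hence the number of subtractions. -/
def divLoop : LoopProgram :=
  .rep 25 14 (.ite (.sub (.add (.reg 18) (.const 1)) (.reg 12))
    (.seq (.assign 18 (.sub (.reg 18) (.reg 12))) (.assign 20 (.add (.reg 20) (.const 1)))) .skip)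

/-- Moves the lowest digit of register `18` to register `x`. -/
def digit (x : ℕ) : LoopProgram :=
  .seq (.assign 20 (.const 0)) <| .seq divLoop <|
  .seq (.assign x (.reg 18)) (.assign 18 (.reg 20))

/-- Recolors a class and counts the vertices whose color changes. -/
def recolor : LoopProgram :=
  .rep 4 2 (.ite (.ne (.read 3 (.reg 4)) (.reg 21)) .skip
    (.ite (.ne (.read 4 (.reg 4)) (.reg 22))
      (.seq (.store 4 (.reg 4) (.reg 22)) (.assign 23 (.add (.reg 23) (.const 1)))) .skip))

/-- Clears register `24` if the current colors are not a list coloring. -/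
def legalTest : LoopProgram :=
  .rep 4 2 <| .seq (clearUnless 24 (.sub (.reg 3) (.read 4 (.reg 4)))) <|
    .seq (clearUnless 24 (listExpr 4 (.read 4 (.reg 4)))) <|
    .rep 10 2 (.ite (adjExpr 4 10)
      (clearUnless 24 (.ne (.read 4 (.reg 4)) (.read 4 (.reg 10)))) .skip)

def move : LoopProgram :=
  .seq (digit 21) <| .seq (digit 22) <| .seq recolor legalTest

def loadIni : LoopProgram := .rep 4 2 (.store 4 (.reg 4) (iniExpr 4))

def targetTest : LoopProgram := .rep 4 2 (clearIf 24 (.ne (.read 4 (.reg 4)) (tarExpr 4)))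

def updateBest : LoopProgram :=
  .ite (.reg 24) (.ite (.reg 0) (.ite (.sub (.reg 1) (.reg 23)) (.assign 1 (.reg 23)) .skip)
    (.seq (.assign 0 (.const 1)) (.assign 1 (.reg 23)))) .skip

/-- Simulates the sequence of moves with the code in register `17`. -/
def trial : LoopProgram :=
  .seq (.assign 18 (.reg 17)) <| .seq (.assign 23 (.const 0)) <| .seq (.assign 24 (.const 1)) <|
  .seq loadIni <| .seq (.rep 19 13 move) <| .seq targetTest updateBest

/-- Register 14 may exceed the number of relevant codes. Larger codes are harmless, since their
superfluous digits are never read. -/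
def search : LoopProgram := .rep 17 14 trial

/-- The program for list coloring shortest reconfiguration on split graphs. -/
def solver : LoopProgram :=
  .seq header <| .seq (.seq tables classify) <| .seq moveBound <| .seq codeBound search

/-! ### Correctness of the program -/

variable {I : ReconfInstance} {s : State}

open Classical in
/-- The memory gives access to the instance `I`. -/
structure Loaded (I : ReconfInstance) (s : State) : Prop where
  n : s.reg 2 = I.n
  k : s.reg 3 = I.k
  adj : ∀ v w : Fin I.n, s.arr 0 (s.arr 1 v + w) = if I.graph.Adj v w then 1 else 0
  list : ∀ (v : Fin I.n) (c : Fin I.k), s.arr 0 (s.arr 2 v + c) = if c ∈ I.lists v then 1 else 0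
  ini : ∀ v : Fin I.n, s.arr 0 (s.reg 6 + v) = I.ini v
  tar : ∀ v : Fin I.n, s.arr 0 (s.reg 7 + v) = I.tar v

theorem Loaded.of_eq (h : Loaded I s) {s' : State} (hr : ∀ x ∈ [2, 3, 6, 7], s'.reg x = s.reg x)
    (ha : ∀ a ∈ [0, 1, 2], s'.arr a = s.arr a) : Loaded I s' := by
  simp only [List.mem_cons, List.not_mem_nil, or_false, forall_eq_or_imp, forall_eq] at hr ha
  obtain ⟨h1, h2, h3, h4⟩ := hr
  obtain ⟨h5, h6, h7⟩ := ha
  constructor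
  · rw [h1, h.n]
  · rw [h2, h.k]
  · rw [h5, h6]
    exact h.adj
  · rw [h5, h7]
    exact h.list
  · rw [h5, h3]
    exact h.ini
  · rw [h5, h4]
    exact h.tar

theorem Loaded.of_agree (h : Loaded I s) {s' : State} {p : LoopProgram} (ha : p.Agree s s')
    (hp : (∀ x ∈ [2, 3, 6, 7], x ∉ p.regs) ∧ ∀ a ∈ [0, 1, 2], a ∉ p.arrs) : Loaded I s' :=
  h.of_eq (fun x hx => ha.1 x (hp.1 x hx)) fun a hx => ha.2 a (hp.2 a hx)

theorem Loaded.exec (h : Loaded I s) {p : LoopProgram}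
    (hp : (∀ x ∈ [2, 3, 6, 7], x ∉ p.regs) ∧ ∀ a ∈ [0, 1, 2], a ∉ p.arrs) : Loaded I (p.exec s) :=
  h.of_agree (p.exec_agree s) hp

theorem clearIf_exec {x : ℕ} {e : Expr} {P : Prop} [Decidable P] (h : e.eval s ≠ 0 ↔ ¬ P) :
    ((clearIf x e).exec s).reg x = if P then s.reg x else 0 := by
  by_cases hP : P
  · rw [if_pos hP, clearIf, LoopProgram.exec_ite_of_eq (by simpa [hP] using h)]
    rfl
  · rw [if_neg hP, clearIf, LoopProgram.exec_ite_of_ne (h.2 hP)]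
    simp [LoopProgram.exec_assign]

theorem clearUnless_exec {x : ℕ} {e : Expr} {P : Prop} [Decidable P] (h : e.eval s ≠ 0 ↔ P) :
    ((clearUnless x e).exec s).reg x = if P then s.reg x else 0 := by
  by_cases hP : P
  · rw [if_pos hP, clearUnless, LoopProgram.exec_ite_of_ne (h.2 hP)]
    rfl
  · rw [if_neg hP, clearUnless, LoopProgram.exec_ite_of_eq (by simpa [hP] using h)]
    simp [LoopProgram.exec_assign]

theorem twinTest_exec (hI : Loaded I s) {u v : Fin I.n} (hu : s.reg 9 = u) (hv : s.reg 4 = v)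
    [Decidable (I.Twins u v)] :
    (twinTest.exec s).reg 11 = if I.Twins u v then 1 else 0 := by
  classical
  simp only [twinTest, LoopProgram.exec_seq, LoopProgram.exec_assign]
  set s₁ := s.setReg 11 ((Expr.const 1).eval s) with hs₁
  have hI₁ : Loaded I s₁ := hI.of_eq (by simp [hs₁]) (by simp [hs₁])
  have a9 : s₁.reg 9 = u := by simp [hs₁, hu]
  have a4 : s₁.reg 4 = v := by simp [hs₁, hv]
  have a11 : s₁.reg 11 = 1 := by simp [hs₁]
  clear_value s₁
  have h2 := LoopProgram.rep_flag (i := 10) (y := 2) (e := 11)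
    (p := clearIf 11 (.ne (adjExpr 9 10) (adjExpr 4 10))) (s := s₁)
    -- The quantifier over `w` with value `m` makes the predicate meaningful for every natural
    -- number `m`.
    (fun m => ∀ w : Fin I.n, (w : ℕ) = m → (I.graph.Adj u w ↔ I.graph.Adj v w))
    (by decide) (by decide) fun m s' hm ha hs' => by
      have hI' := hI₁.of_agree ha (by decide)
      rw [hI₁.n] at hm
      refine clearIf_exec ?_
      rw [Expr.ne_eval, adjExpr, adjExpr]
      simp only [Expr.eval, ha.1 9 (by decide), ha.1 4 (by decide), a9, a4, hs']
      rw [hI'.adj u ⟨m, hm⟩, hI'.adj v ⟨m, hm⟩]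
      constructor
      · intro h h'
        exact h (if_congr (h' ⟨m, hm⟩ rfl) rfl rfl)
      · intro h h'
        refine h ?_
        rintro w rfl
        by_cases h1 : I.graph.Adj u w <;> by_cases h2 : I.graph.Adj v w <;> simp_all
  set s₂ := (LoopProgram.rep 10 2 (clearIf 11 (.ne (adjExpr 9 10) (adjExpr 4 10)))).exec s₁ with hs₂
  have hI₂ : Loaded I s₂ := hI₁.exec (by decide)
  have b9 : s₂.reg 9 = u := by rw [hs₂, LoopProgram.exec_reg (by decide), a9]
  have b4 : s₂.reg 4 = v := by rw [hs₂, LoopProgram.exec_reg (by decide), a4]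
  clear_value s₂
  have h3 := LoopProgram.rep_flag (i := 10) (y := 3) (e := 11)
    (p := clearIf 11 (.ne (listExpr 9 (.reg 10)) (listExpr 4 (.reg 10)))) (s := s₂)
    (fun m => ∀ c : Fin I.k, (c : ℕ) = m → (c ∈ I.lists u ↔ c ∈ I.lists v))
    (by decide) (by decide) fun m s' hm ha hs' => by
      have hI' := hI₂.of_agree ha (by decide)
      rw [hI₂.k] at hm
      refine clearIf_exec ?_
      rw [Expr.ne_eval, listExpr, listExpr]
      simp only [Expr.eval, ha.1 9 (by decide), ha.1 4 (by decide), b9, b4, hs']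
      rw [hI'.list u ⟨m, hm⟩, hI'.list v ⟨m, hm⟩]
      constructor
      · intro h h'
        exact h (if_congr (h' ⟨m, hm⟩ rfl) rfl rfl)
      · intro h h'
        refine h ?_
        rintro w rfl
        by_cases h1 : w ∈ I.lists u <;> by_cases h2 : w ∈ I.lists v <;> simp_all
  set s₃ := (LoopProgram.rep 10 3
    (clearIf 11 (.ne (listExpr 9 (.reg 10)) (listExpr 4 (.reg 10))))).exec s₂ with hs₃
  have hI₃ : Loaded I s₃ := hI₂.exec (by decide)
  have c9 : s₃.reg 9 = u := by rw [hs₃, LoopProgram.exec_reg (by decide), b9]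
  have c4 : s₃.reg 4 = v := by rw [hs₃, LoopProgram.exec_reg (by decide), b4]
  clear_value s₃
  have h4 := clearIf_exec (s := s₃) (x := 11) (e := .ne (iniExpr 9) (iniExpr 4))
    (P := I.ini u = I.ini v) (by
      rw [Expr.ne_eval, iniExpr, iniExpr]
      simp only [Expr.eval, c9, c4, hI₃.ini, ne_eq, Fin.ext_iff])
  set s₄ := (clearIf 11 (.ne (iniExpr 9) (iniExpr 4))).exec s₃ with hs₄
  have hI₄ : Loaded I s₄ := hI₃.exec (by decide)
  have d9 : s₄.reg 9 = u := by rw [hs₄, LoopProgram.exec_reg (by decide), c9]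
  have d4 : s₄.reg 4 = v := by rw [hs₄, LoopProgram.exec_reg (by decide), c4]
  clear_value s₄
  rw [clearIf_exec (s := s₄) (x := 11) (e := .ne (tarExpr 9) (tarExpr 4))
    (P := I.tar u = I.tar v) (by
      rw [Expr.ne_eval, tarExpr, tarExpr]
      simp only [Expr.eval, d9, d4, hI₄.tar, ne_eq, Fin.ext_iff]), h4, h3, h2, a11,
    hI₁.n, hI₂.k]
  have e1 : (∀ m < I.n, ∀ w : Fin I.n, (w : ℕ) = m → (I.graph.Adj u w ↔ I.graph.Adj v w)) ↔
      ∀ w, I.graph.Adj u w ↔ I.graph.Adj v w :=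
    ⟨fun h w => h w w.2 w rfl, fun h m _ w _ => h w⟩
  have e2 : (∀ m < I.k, ∀ c : Fin I.k, (c : ℕ) = m → (c ∈ I.lists u ↔ c ∈ I.lists v)) ↔
      I.lists u = I.lists v :=
    ⟨fun h => Finset.ext fun c => h c c.2 c rfl, fun h m _ c _ => by rw [h]⟩
  simp only [e1, e2, ← ite_and]
  exact if_congr ⟨fun h => ⟨h.2.2.2, h.2.2.1, h.2.1, h.1⟩, fun h => ⟨h.2.2.2, h.2.2.1, h.2.1, h.1⟩⟩
    rfl rfl

/-- The entry of `v` is overwritten by the class of each smaller twin met. Only this entry is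
written, so the class read for a smaller vertex is still the original one. -/
theorem findTwin_exec (hI : Loaded I s) {v : Fin I.n} (hv : s.reg 4 = v) :
    (∀ j, j ≠ (v : ℕ) → (findTwin.exec s).arr 3 j = s.arr 3 j) ∧
    ((∃ u < v, I.Twins u v ∧ (findTwin.exec s).arr 3 v = s.arr 3 u) ∨
      (∀ u < v, ¬ I.Twins u v) ∧ (findTwin.exec s).arr 3 v = s.arr 3 v) := by
  classical
  have := LoopProgram.rep_induct (i := 9) (y := 2) (s := s) (p := .seq twinTest (.ite (.reg 11)
    (.ite (.sub (.reg 4) (.reg 9)) (.store 3 (.reg 4) (.read 3 (.reg 9))) .skip) .skip))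
    (fun m s' => (∀ j, j ≠ (v : ℕ) → s'.arr 3 j = s.arr 3 j) ∧
      ((∃ u < v, I.Twins u v ∧ s'.arr 3 v = s.arr 3 u) ∨
      (∀ u < v, (u : ℕ) < m → ¬ I.Twins u v) ∧ s'.arr 3 v = s.arr 3 v)) (by decide)
    (by simp) fun m s' hm ha hs' ih => by
      have hI' := hI.of_agree ha (by decide)
      rw [hI.n] at hm
      have h4 : s'.reg 4 = v := by rw [ha.1 4 (by decide), hv]
      have h11 := twinTest_exec hI' (u := ⟨m, hm⟩) hs' h4
      have h3 : (twinTest.exec s').arr 3 = s'.arr 3 := LoopProgram.exec_arr (by decide) _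
      have h4' : (twinTest.exec s').reg 4 = v := by rw [LoopProgram.exec_reg (by decide), h4]
      have h9 : (twinTest.exec s').reg 9 = m := by rw [LoopProgram.exec_reg (by decide), hs']
      rw [LoopProgram.exec_seq, State.setReg_arr]
      have h9' : (Expr.sub (.reg 4) (.reg 9)).eval (twinTest.exec s') = v - m := by
        simp only [Expr.eval, h4', h9]
      by_cases htw : I.Twins ⟨m, hm⟩ v
      · by_cases hlt : m < v
        · rw [LoopProgram.exec_ite_of_ne (by simp [h11, htw]),
            LoopProgram.exec_ite_of_ne (by omega), LoopProgram.exec_store]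
          refine ⟨fun j hj => ?_, Or.inl ⟨⟨m, hm⟩, hlt, htw, ?_⟩⟩
          · simp [hj, h3, ih.1, h4']
          · simp [h3, ih.1 m hlt.ne, h4', h9]
        · rw [LoopProgram.exec_ite_of_ne (by simp [h11, htw]),
            LoopProgram.exec_ite_of_eq (by omega), LoopProgram.exec_skip, h3]
          refine ⟨ih.1, ih.2.imp_right fun h => ⟨fun u hu hum => h.1 u hu ?_, h.2⟩⟩
          have : (u : ℕ) < v := hu
          omega
      · rw [LoopProgram.exec_ite_of_eq (by simp [h11, htw]), LoopProgram.exec_skip, h3]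
        refine ⟨ih.1, ih.2.imp_right fun h => ⟨fun u hu hum => ?_, h.2⟩⟩
        rcases Nat.lt_succ_iff_lt_or_eq.1 hum with hum | hum
        · exact h.1 u hu hum
        · obtain rfl : u = ⟨m, hm⟩ := Fin.ext hum
          exact htw
  refine ⟨this.1, this.2.imp_right fun h => ⟨fun u hu => h.1 u hu ?_, h.2⟩⟩
  rw [hI.n]
  exact u.2

theorem Twins.symm {u v : Fin I.n} (h : I.Twins u v) : I.Twins v u :=
  ⟨fun w => (h.1 w).symm, h.2.1.symm, h.2.2.1.symm, h.2.2.2.symm⟩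

theorem Twins.trans {u v w : Fin I.n} (h : I.Twins u v) (h' : I.Twins v w) : I.Twins u w :=
  ⟨fun x => (h.1 x).trans (h'.1 x), h.2.1.trans h'.2.1, h.2.2.1.trans h'.2.2.1,
    h.2.2.2.trans h'.2.2.2⟩

/-- A new vertex first receives the unused number in register 8. All classes assigned before are
smaller, so the entry differs from register 8 afterwards exactly if a smaller twin was found;
otherwise a new class is opened. -/
theorem classify_exec (hI : Loaded I s) :
    I.IsClassification ((classify.exec s).arr 3) ((classify.exec s).reg 8) := by
  have := LoopProgram.rep_induct (i := 4) (y := 2) (s := s.setReg 8 0)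
    (p := .seq (.store 3 (.reg 4) (.reg 8)) <| .seq findTwin <|
      .ite (.ne (.read 3 (.reg 4)) (.reg 8)) .skip (.assign 8 (.add (.reg 8) (.const 1))))
    (fun m s' => (∀ u v : Fin I.n, (u : ℕ) < m → (v : ℕ) < m →
        (s'.arr 3 u = s'.arr 3 v ↔ I.Twins u v)) ∧
      (∀ v : Fin I.n, (v : ℕ) < m → s'.arr 3 v < s'.reg 8) ∧
      ∀ j < s'.reg 8, ∃ v : Fin I.n, (v : ℕ) < m ∧ s'.arr 3 v = j) (by decide)
    (by simp) fun m s' hm ha hs' ih => by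
      have hI' := (hI.of_eq (s' := s.setReg 8 0) (by simp) (by simp)).of_agree ha (by decide)
      have hm : m < I.n := by simpa [hI.n] using hm
      obtain ⟨ih1, ih2, ih3⟩ := ih
      set s₁ := s'.setArr 3 m (s'.reg 8) with hs₁
      have hI₁ : Loaded I s₁ := hI'.of_eq (by simp [hs₁]) (by
        intro a ha
        rw [hs₁, State.setArr_arr_of_ne]
        rintro rfl
        simp at ha)
      have a4 : s₁.reg 4 = ((⟨m, hm⟩ : Fin I.n) : ℕ) := hs'
      obtain ⟨h1, h2⟩ := findTwin_exec hI₁ a4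
      have h8 : (findTwin.exec s₁).reg 8 = s'.reg 8 := LoopProgram.exec_reg (by decide) _
      have h4 : (findTwin.exec s₁).reg 4 = m := (LoopProgram.exec_reg (by decide) _).trans a4
      have e1 : ∀ j < m, s₁.arr 3 j = s'.arr 3 j := fun j hj => by simp [hs₁, hj.ne]
      have e2 : s₁.arr 3 m = s'.reg 8 := by simp [hs₁]
      have e0 : s'.setArr 3 ((Expr.reg 4).eval s') ((Expr.reg 8).eval s') = s₁ := by
        simp only [Expr.eval, hs', hs₁]
      clear_value s₁
      rw [LoopProgram.exec_seq, LoopProgram.exec_seq, LoopProgram.exec_store, e0]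
      set s₂ := findTwin.exec s₁
      clear_value s₂
      have g1 : ∀ j < m, s₂.arr 3 j = s'.arr 3 j := fun j hj => by rw [h1 j hj.ne, e1 j hj]
      have hne := Expr.ne_eval (e₁ := .read 3 (.reg 4)) (e₂ := .reg 8) (s := s₂)
      simp only [Expr.eval, h4, h8] at hne
      rcases h2 with ⟨u, hu, htw, h2⟩ | ⟨htw, h2⟩
      · have hu' : (u : ℕ) < m := hu
        rw [e1 u hu'] at h2
        have hlt := ih2 u hu'
        dsimp only at h2
        rw [LoopProgram.exec_ite_of_ne (hne.2 (by rw [h2]; exact hlt.ne)), LoopProgram.exec_skip]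
        simp only [State.setReg_arr, State.setReg_reg, h8]
        rw [if_neg (by decide)]
        refine ⟨fun x y hx hy => ?_, fun x hx => ?_, fun j hj => ?_⟩
        · rcases Nat.lt_succ_iff_lt_or_eq.1 hx with hx | hx <;>
            rcases Nat.lt_succ_iff_lt_or_eq.1 hy with hy | hy
          · rw [g1 _ hx, g1 _ hy, ih1 _ _ hx hy]
          · obtain rfl : y = ⟨m, hm⟩ := Fin.ext hy
            rw [g1 _ hx, h2, ih1 _ _ hx hu']
            exact ⟨fun h => h.trans htw, fun h => h.trans htw.symm⟩
          · obtain rfl : x = ⟨m, hm⟩ := Fin.ext hx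
            rw [g1 _ hy, h2, ih1 _ _ hu' hy]
            exact ⟨fun h => htw.symm.trans h, fun h => htw.trans h⟩
          · obtain rfl : x = ⟨m, hm⟩ := Fin.ext hx
            obtain rfl : y = ⟨m, hm⟩ := Fin.ext hy
            exact ⟨fun _ => ⟨fun _ => .rfl, rfl, rfl, rfl⟩, fun _ => rfl⟩
        · rcases Nat.lt_succ_iff_lt_or_eq.1 hx with hx | hx
          · rw [g1 _ hx]
            exact ih2 x hx
          · rw [hx, h2]
            exact hlt
        · obtain ⟨x, hx, hxj⟩ := ih3 j hj
          exact ⟨x, by omega, by rw [g1 _ hx, hxj]⟩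
      · dsimp only at h2
        rw [e2] at h2
        rw [LoopProgram.exec_ite_of_eq (by simpa [h2] using hne), LoopProgram.exec_assign]
        simp only [State.setReg_arr, State.setReg_reg, Expr.eval, h8]
        rw [if_neg (by decide), if_pos trivial]
        refine ⟨fun x y hx hy => ?_, fun x hx => ?_, fun j hj => ?_⟩
        · rcases Nat.lt_succ_iff_lt_or_eq.1 hx with hx | hx <;>
            rcases Nat.lt_succ_iff_lt_or_eq.1 hy with hy | hy
          · rw [g1 _ hx, g1 _ hy, ih1 _ _ hx hy]
          · obtain rfl : y = ⟨m, hm⟩ := Fin.ext hy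
            rw [g1 _ hx, h2]
            exact ⟨fun h => absurd h (ih2 x hx).ne, fun h => absurd h (htw x hx)⟩
          · obtain rfl : x = ⟨m, hm⟩ := Fin.ext hx
            rw [g1 _ hy, h2]
            exact ⟨fun h => absurd h.symm (ih2 y hy).ne, fun h => absurd h.symm (htw y hy)⟩
          · obtain rfl : x = ⟨m, hm⟩ := Fin.ext hx
            obtain rfl : y = ⟨m, hm⟩ := Fin.ext hy
            exact ⟨fun _ => ⟨fun _ => .rfl, rfl, rfl, rfl⟩, fun _ => rfl⟩
        · rcases Nat.lt_succ_iff_lt_or_eq.1 hx with hx | hx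
          · rw [g1 _ hx]
            have := ih2 x hx
            omega
          · rw [hx, h2]
            omega
        · rcases Nat.lt_succ_iff_lt_or_eq.1 hj with hj | hj
          · obtain ⟨x, hx, hxj⟩ := ih3 j hj
            exact ⟨x, by omega, by rw [g1 _ hx, hxj]⟩
          · exact ⟨⟨m, hm⟩, by simp, by rw [hj]; exact h2⟩
  have hn : (s.setReg 8 0).reg 2 = I.n := by simp [hI.n]
  rw [hn] at this
  obtain ⟨h1, h2, h3⟩ := this
  exact ⟨fun u v => h1 u v u.2 v.2, fun v => h2 v v.2, fun j hj => (h3 j hj).imp fun v hv => hv.2⟩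

theorem moveBound_exec (s : State) : (moveBound.exec s).reg 12 = s.reg 8 + s.reg 3 + 1 ∧
    (moveBound.exec s).reg 13 = (2 ^ s.reg 8) ^ s.reg 3 := by
  constructor
  · simp only [moveBound, LoopProgram.exec_seq, LoopProgram.exec_assign]
    exact (LoopProgram.exec_reg (p := .rep 15 3 (.rep 16 8 (double 13))) (by decide) _).trans
      (by simp)
  · simp only [moveBound, LoopProgram.exec_seq, LoopProgram.exec_assign]
    refine (LoopProgram.rep_mul (a := 2 ^ s.reg 8) (p := .rep 16 8 (double 13)) (by decide)
      (by decide) fun s' ha => ?_).trans (by simp)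
    have := ha.1 8 (by decide)
    simp only [State.setReg_reg] at this
    norm_num at this
    rw [← this]
    exact LoopProgram.rep_mul (by decide) (by decide) fun s' _ => by
      simp [double, LoopProgram.exec, two_mul]

theorem codeBound_exec (s : State) :
    (codeBound.exec s).reg 14 = (4 ^ s.reg 13) ^ s.reg 12 := by
  simp only [codeBound, LoopProgram.exec_seq, LoopProgram.exec_assign]
  refine (LoopProgram.rep_mul (a := 4 ^ s.reg 13)
    (p := .rep 16 13 (.seq (double 14) (double 14))) (by decide)
    (by decide) fun s' ha => ?_).trans (by simp)
  have := ha.1 13 (by decide)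
  simp only [State.setReg_reg] at this
  norm_num at this
  rw [← this]
  exact LoopProgram.rep_mul (by decide) (by decide) fun s' _ => by
    simp [double, LoopProgram.exec_seq, LoopProgram.exec_assign]
    omega

end ReconfInstance

/-! ### The simulation of moves and the search in memory -/

namespace ReconfInstance

open RAM ListColoring

variable {I : ReconfInstance} {s : State}

theorem divLoop_exec (hs : s.reg 18 ≤ s.reg 14) (hb : 0 < s.reg 12) (hq : s.reg 20 = 0) :
    (divLoop.exec s).reg 18 = s.reg 18 % s.reg 12 ∧
    (divLoop.exec s).reg 20 = s.reg 18 / s.reg 12 := by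
  have : (divLoop.exec s).reg 18 + s.reg 12 * (divLoop.exec s).reg 20 = s.reg 18 ∧
      ((divLoop.exec s).reg 18 < s.reg 12 ∨ (divLoop.exec s).reg 20 = s.reg 14) :=
    LoopProgram.rep_induct (i := 25) (y := 14) (s := s)
    (p := .ite (.sub (.add (.reg 18) (.const 1)) (.reg 12))
      (.seq (.assign 18 (.sub (.reg 18) (.reg 12))) (.assign 20 (.add (.reg 20) (.const 1)))) .skip)
    (fun m s' => s'.reg 18 + s.reg 12 * s'.reg 20 = s.reg 18 ∧
      (s'.reg 18 < s.reg 12 ∨ s'.reg 20 = m)) (by decide)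
    (by simp [hq]) fun m s' hm ha hs' ih => by
      have h12 : s'.reg 12 = s.reg 12 := ha.1 12 (by decide)
      obtain ⟨ih1, ih2⟩ := ih
      by_cases hlt : s'.reg 18 < s.reg 12
      · rw [LoopProgram.exec_ite_of_eq (by simp only [Expr.eval, h12]; omega),
          LoopProgram.exec_skip]
        simp [ih1, hlt]
      · rw [LoopProgram.exec_ite_of_ne (by simp only [Expr.eval, h12]; omega)]
        simp only [LoopProgram.exec_seq, LoopProgram.exec_assign, Expr.eval, State.setReg_reg,
          h12]
        norm_num
        rw [mul_add]
        omega
  obtain ⟨h1, h2⟩ := this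
  -- If every round subtracted, the quotient is `s.reg 14`, which is at least the dividend; as the
  -- base is positive, the remainder is then `0`.
  have hlt : (divLoop.exec s).reg 18 < s.reg 12 := by
    refine h2.elim id fun h2 => ?_
    rw [h2] at h1
    have := Nat.le_mul_of_pos_left (s.reg 14) hb
    omega
  rw [← h1]
  exact ⟨by rw [Nat.add_mul_mod_self_left, Nat.mod_eq_of_lt hlt],
    by rw [Nat.add_mul_div_left _ _ hb, Nat.div_eq_of_lt hlt, zero_add]⟩

theorem digit_exec {x : ℕ} (hx : x ≠ 18 ∧ x ≠ 20) (hs : s.reg 18 ≤ s.reg 14) (hb : 0 < s.reg 12) :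
    ((digit x).exec s).reg x = s.reg 18 % s.reg 12 ∧
    ((digit x).exec s).reg 18 = s.reg 18 / s.reg 12 := by
  obtain ⟨h1, h2⟩ := divLoop_exec (s := s.setReg 20 0) (by simpa using hs) (by simpa using hb)
    (by simp)
  simp only [digit, LoopProgram.exec_seq, LoopProgram.exec_assign, Expr.eval, State.setReg_reg, h2,
    h1]
  simp [hx.1, hx.2.symm]

theorem recolor_exec (s : State) :
    (recolor.exec s).arr 4 =
      (fun v => if v < s.reg 2 ∧ s.arr 3 v = s.reg 21 then s.reg 22 else s.arr 4 v) ∧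
    (recolor.exec s).reg 23 = s.reg 23 + ((Finset.range (s.reg 2)).filter
      fun v => s.arr 3 v = s.reg 21 ∧ s.arr 4 v ≠ s.reg 22).card := by
  refine LoopProgram.rep_induct (fun m s' =>
    s'.arr 4 = (fun v => if v < m ∧ s.arr 3 v = s.reg 21 then s.reg 22 else s.arr 4 v) ∧
    s'.reg 23 = s.reg 23 + ((Finset.range m).filter
      fun v => s.arr 3 v = s.reg 21 ∧ s.arr 4 v ≠ s.reg 22).card) (by decide)
    (by simp) fun m s' hm ha hs' ih => ?_
  obtain ⟨ih1, ih2⟩ := ih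
  have h21 : s'.reg 21 = s.reg 21 := ha.1 21 (by decide)
  have h22 : s'.reg 22 = s.reg 22 := ha.1 22 (by decide)
  have h3 : s'.arr 3 = s.arr 3 := ha.2 3 (by decide)
  have h4 : s'.arr 4 m = s.arr 4 m := by rw [ih1]; simp
  have hne1 := Expr.ne_eval (e₁ := .read 3 (.reg 4)) (e₂ := .reg 21) (s := s')
  have hne2 := Expr.ne_eval (e₁ := .read 4 (.reg 4)) (e₂ := .reg 22) (s := s')
  simp only [Expr.eval, h21, h22, h3, hs', h4] at hne1 hne2
  rw [Finset.range_add_one, Finset.filter_insert]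
  by_cases hc : s.arr 3 m = s.reg 21
  · rw [LoopProgram.exec_ite_of_eq (by simpa [hc] using hne1)]
    by_cases hd : s.arr 4 m = s.reg 22
    · rw [LoopProgram.exec_ite_of_eq (by simpa [hd] using hne2), LoopProgram.exec_skip,
        if_neg (by simp [hd])]
      refine ⟨?_, by simpa using ih2⟩
      ext v
      simp only [State.setReg_arr, ih1]
      by_cases hv : v = m
      · subst hv
        simp [hc, hd]
      · exact if_congr (and_congr_left' (by omega)) rfl rfl
    · rw [LoopProgram.exec_ite_of_ne (hne2.2 hd), if_pos ⟨hc, hd⟩,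
        Finset.card_insert_of_notMem (by simp)]
      simp only [LoopProgram.exec_seq, LoopProgram.exec_assign, LoopProgram.exec_store, Expr.eval,
        State.setReg_arr, hs', h22]
      refine ⟨?_, by simp [ih2]; omega⟩
      ext v
      rw [State.setArr_arr, ih1]
      by_cases hv : v = m
      · subst hv
        simp [hc]
      · simp only [hv, and_false, if_false]
        exact if_congr (and_congr_left' (by omega)) rfl rfl
  · rw [LoopProgram.exec_ite_of_ne (hne1.2 hc), LoopProgram.exec_skip, if_neg (by simp [hc])]
    refine ⟨?_, by simpa using ih2⟩
    ext v
    simp only [State.setReg_arr, ih1]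
    by_cases hv : v = m
    · subst hv
      simp [hc]
    · exact if_congr (and_congr_left' (by omega)) rfl rfl

/-- Splits legality into conditions on single vertices and edges, the form in which `legalTest`
checks it. -/
theorem exists_represents_iff {cur : ℕ → ℕ} :
    (∃ f : I.graph.Coloring (Fin I.k), Represents cur f) ↔
      ∀ v : Fin I.n, (∃ c ∈ I.lists v, (c : ℕ) = cur v) ∧
        ∀ w : Fin I.n, I.graph.Adj v w → cur v ≠ cur w := by
  constructor
  · rintro ⟨f, hf⟩ v
    refine ⟨⟨f v, hf.1 v, (hf.2 v).symm⟩, fun w hw => ?_⟩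
    rw [hf.2, hf.2, ne_eq, ← Fin.ext_iff]
    exact f.valid hw
  · intro h
    choose f hf hf' using fun v => (h v).1
    refine ⟨.mk f fun {v w} hvw heq => (h v).2 w hvw ?_, hf, fun v => (hf' v).symm⟩
    rw [← hf', ← hf', heq]

theorem legalTest_exec (hI : Loaded I s)
    [Decidable (∃ f : I.graph.Coloring (Fin I.k), Represents (s.arr 4) f)] :
    (legalTest.exec s).reg 24 =
      if ∃ f : I.graph.Coloring (Fin I.k), Represents (s.arr 4) f then s.reg 24 else 0 := by
  classical
  refine (LoopProgram.rep_flag (e := 24) (fun m => ∀ v : Fin I.n, (v : ℕ) = m →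
    (∃ c ∈ I.lists v, (c : ℕ) = s.arr 4 v) ∧
      ∀ w : Fin I.n, I.graph.Adj v w → s.arr 4 v ≠ s.arr 4 w)
    (by decide) (by decide) fun m s' hm ha hs' => ?_).trans ?_
  · rw [hI.n] at hm
    have hI' := hI.of_agree ha (by decide)
    have h4 : s'.arr 4 = s.arr 4 := ha.2 4 (by decide)
    clear ha
    rw [LoopProgram.exec_seq, LoopProgram.exec_seq]
    -- A base-`b` digit need not be a color. For a value of at least `k` the list lookup reads an
    -- unrelated cell, but by then this test has cleared the flag.
    have e1 := clearUnless_exec (s := s') (x := 24) (e := .sub (.reg 3) (.read 4 (.reg 4)))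
      (P := s.arr 4 m < I.k) (by
        simp only [Expr.eval, hI'.k, h4, hs']
        omega)
    set s₁ := (clearUnless 24 (.sub (.reg 3) (.read 4 (.reg 4)))).exec s' with hs₁
    have hI₁ : Loaded I s₁ := hI'.exec (by decide)
    have b4 : s₁.reg 4 = m := by rw [hs₁, LoopProgram.exec_reg (by decide), hs']
    have a4 : s₁.arr 4 = s.arr 4 := by rw [hs₁, LoopProgram.exec_arr (by decide), h4]
    clear_value s₁
    have e2 := clearUnless_exec (s := s₁) (x := 24) (e := listExpr 4 (.read 4 (.reg 4)))
      (P := s₁.arr 0 (s₁.arr 2 m + s.arr 4 m) ≠ 0) (by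
        simp only [listExpr, Expr.eval, a4, b4])
    set s₂ := (clearUnless 24 (listExpr 4 (.read 4 (.reg 4)))).exec s₁ with hs₂
    have hI₂ : Loaded I s₂ := hI₁.exec (by decide)
    have c4 : s₂.reg 4 = m := by rw [hs₂, LoopProgram.exec_reg (by decide), b4]
    have d4 : s₂.arr 4 = s.arr 4 := by rw [hs₂, LoopProgram.exec_arr (by decide), a4]
    clear_value s₂
    rw [LoopProgram.rep_flag (e := 24) (fun l => ∀ w : Fin I.n, (w : ℕ) = l →
      I.graph.Adj ⟨m, hm⟩ w → s.arr 4 m ≠ s.arr 4 w) (by decide) (by decide), e2, e1, hI₂.n,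
      ← ite_and, ← ite_and]
    · refine if_congr ?_ rfl rfl
      constructor
      · rintro ⟨⟨h1, h2⟩, h3⟩ v rfl
        refine ⟨⟨⟨_, h3⟩, ?_, rfl⟩, fun w hw => h1 w w.2 w rfl hw⟩
        by_contra hc
        exact h2 ((hI₁.list v ⟨_, h3⟩).trans (if_neg hc))
      · intro h
        obtain ⟨⟨c, hc, hcm⟩, h2⟩ := h ⟨m, hm⟩ rfl
        dsimp only at hcm h2
        refine ⟨⟨fun l _ w _ hw => h2 w hw, ?_⟩, by rw [← hcm]; exact c.2⟩
        have := hI₁.list ⟨m, hm⟩ c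
        rw [if_pos hc, hcm] at this
        dsimp only at this
        rw [this]
        exact one_ne_zero
    · intro l s'' hl ha hl'
      rw [hI₂.n] at hl
      have hI'' := hI₂.of_agree ha (by decide)
      have f4 : s''.reg 4 = m := (ha.1 4 (by decide)).trans c4
      have g4 : s''.arr 4 = s.arr 4 := (ha.2 4 (by decide)).trans d4
      have hadj : (adjExpr 4 10).eval s'' = if I.graph.Adj ⟨m, hm⟩ ⟨l, hl⟩ then 1 else 0 := by
        rw [← hI''.adj]
        simp only [adjExpr, Expr.eval, f4, hl']
      by_cases h : I.graph.Adj ⟨m, hm⟩ ⟨l, hl⟩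
      · rw [LoopProgram.exec_ite_of_ne (by rw [hadj, if_pos h]; exact one_ne_zero)]
        refine (clearUnless_exec (P := s.arr 4 m ≠ s.arr 4 l) ?_).trans (if_congr ?_ rfl rfl)
        · rw [Expr.ne_eval]
          simp only [Expr.eval, f4, g4, hl']
        · refine ⟨?_, fun h' => h' ⟨l, hl⟩ rfl h⟩
          rintro h' w rfl _
          exact h'
      · rw [LoopProgram.exec_ite_of_eq (by rw [hadj, if_neg h]), LoopProgram.exec_skip, if_pos]
        rintro w rfl hw
        exact absurd hw h
  · rw [hI.n]
    refine if_congr ?_ rfl rfl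
    rw [exists_represents_iff]
    exact ⟨fun h v => h v v.2 v rfl, fun h m _ v _ => h v⟩

/-- The state of the simulation of a sequence of moves that is stored in the memory. -/
def simulation (s : State) : Simulation := ⟨s.reg 18, s.reg 23, s.reg 24, s.arr 4⟩

theorem move_exec (hI : Loaded I s) (hs : s.reg 18 ≤ s.reg 14) (hb : 0 < s.reg 12) :
    simulation (move.exec s) = step I (s.arr 3) (s.reg 12) (simulation s) := by
  classical
  simp only [move, LoopProgram.exec_seq]
  obtain ⟨h1, h2⟩ := digit_exec (x := 21) (by decide) hs hb
  set s₁ := (digit 21).exec s with hs₁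
  have hI₁ : Loaded I s₁ := hI.exec (by decide)
  have a12 : s₁.reg 12 = s.reg 12 := LoopProgram.exec_reg (by decide) _
  have a14 : s₁.reg 14 = s.reg 14 := LoopProgram.exec_reg (by decide) _
  have a23 : s₁.reg 23 = s.reg 23 := LoopProgram.exec_reg (by decide) _
  have a24 : s₁.reg 24 = s.reg 24 := LoopProgram.exec_reg (by decide) _
  have a3 : s₁.arr 3 = s.arr 3 := LoopProgram.exec_arr (by decide) _
  have a4 : s₁.arr 4 = s.arr 4 := LoopProgram.exec_arr (by decide) _
  clear_value s₁
  obtain ⟨h3, h4⟩ := digit_exec (s := s₁) (x := 22) (by decide)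
    (by rw [h2, a14]; exact (Nat.div_le_self _ _).trans hs) (by rwa [a12])
  rw [h2, a12] at h3 h4
  set s₂ := (digit 22).exec s₁ with hs₂
  have hI₂ : Loaded I s₂ := hI₁.exec (by decide)
  have b21 : s₂.reg 21 = s.reg 18 % s.reg 12 := (LoopProgram.exec_reg (by decide) _).trans h1
  have b23 : s₂.reg 23 = s.reg 23 := (LoopProgram.exec_reg (by decide) _).trans a23
  have b24 : s₂.reg 24 = s.reg 24 := (LoopProgram.exec_reg (by decide) _).trans a24
  have b3 : s₂.arr 3 = s.arr 3 := (LoopProgram.exec_arr (by decide) _).trans a3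
  have b4 : s₂.arr 4 = s.arr 4 := (LoopProgram.exec_arr (by decide) _).trans a4
  clear_value s₂
  obtain ⟨h5, h6⟩ := recolor_exec s₂
  rw [b3, b4, b21, h3, hI₂.n] at h5
  rw [b3, b4, b21, h3, hI₂.n, b23] at h6
  set s₃ := recolor.exec s₂ with hs₃
  have hI₃ : Loaded I s₃ := hI₂.exec (by decide)
  have c18 : s₃.reg 18 = s.reg 18 / s.reg 12 / s.reg 12 :=
    (LoopProgram.exec_reg (by decide) _).trans h4
  have c24 : s₃.reg 24 = s.reg 24 := (LoopProgram.exec_reg (by decide) _).trans b24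
  clear_value s₃
  have h7 := legalTest_exec hI₃
  rw [c24] at h7
  simp only [h5] at h7
  simp only [simulation, step, Simulation.mk.injEq]
  refine ⟨(LoopProgram.exec_reg (by decide) _).trans c18,
    (LoopProgram.exec_reg (by decide) _).trans h6, ?_,
    (LoopProgram.exec_arr (by decide) _).trans h5⟩
  rw [h7]
  exact if_congr .rfl rfl rfl

/-- The invariant also records that the remaining code stays below register 14, which the bounded
division loop requires; dividing only decreases the code. -/
theorem moves_exec (hI : Loaded I s) (hs : s.reg 18 ≤ s.reg 14) (hb : 0 < s.reg 12) :
    simulation ((LoopProgram.rep 19 13 move).exec s) =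
      (step I (s.arr 3) (s.reg 12))^[s.reg 13] (simulation s) := by
  refine (LoopProgram.rep_induct (fun m s' => s'.reg 18 ≤ s.reg 14 ∧
    simulation s' = (step I (s.arr 3) (s.reg 12))^[m] (simulation s)) (by decide)
    ⟨by simpa using hs, by simp [simulation]⟩ fun m s' _ ha _ ih => ?_).2
  have hI' := hI.of_agree ha (by decide)
  have h12 : s'.reg 12 = s.reg 12 := ha.1 12 (by decide)
  have h14 : s'.reg 14 = s.reg 14 := ha.1 14 (by decide)
  have h3 : s'.arr 3 = s.arr 3 := ha.2 3 (by decide)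
  have key := move_exec hI' (h14 ▸ ih.1) (h12 ▸ hb)
  rw [h3, h12, ih.2, ← Function.iterate_succ_apply' (step I (s.arr 3) (s.reg 12))] at key
  have e : simulation ((move.exec s').setReg 19 (m + 1)) = simulation (move.exec s') := by
    simp [simulation]
  refine ⟨?_, e.trans key⟩
  have hcode := congrArg Simulation.code (move_exec hI' (h14 ▸ ih.1) (h12 ▸ hb))
  simp only [simulation, step] at hcode
  simp only [State.setReg_reg]
  norm_num
  rw [hcode]
  exact ((Nat.div_le_self _ _).trans (Nat.div_le_self _ _)).trans ih.1

theorem loadIni_exec (hI : Loaded I s) (v : Fin I.n) : (loadIni.exec s).arr 4 v = I.ini v := by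
  refine (LoopProgram.rep_store (fun v => s.arr 0 (s.reg 6 + v)) (by decide)
    (fun m s' _ ha hs' j => ?_) v).trans ?_
  · have h6 : s'.reg 6 = s.reg 6 := ha.1 6 (by decide)
    have h0 : s'.arr 0 = s.arr 0 := ha.2 0 (by decide)
    simp only [LoopProgram.exec_store, State.setArr_arr, iniExpr, Expr.eval, hs', h6, h0, true_and]
    split_ifs with h
    · rw [h]
    · rfl
  · rw [hI.n, if_pos v.2, hI.ini]

theorem targetTest_exec (hI : Loaded I s) [Decidable (∀ v : Fin I.n, s.arr 4 v = I.tar v)] :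
    (targetTest.exec s).reg 24 = if ∀ v : Fin I.n, s.arr 4 v = I.tar v then s.reg 24 else 0 := by
  classical
  refine (LoopProgram.rep_flag (e := 24) (fun m => ∀ v : Fin I.n, (v : ℕ) = m →
    s.arr 4 v = I.tar v) (by decide) (by decide) fun m s' hm ha hs' => ?_).trans ?_
  · rw [hI.n] at hm
    have hI' := hI.of_agree ha (by decide)
    have h4 : s'.arr 4 = s.arr 4 := ha.2 4 (by decide)
    refine clearIf_exec ?_
    rw [Expr.ne_eval]
    simp only [tarExpr, Expr.eval, h4, hs']
    rw [hI'.tar ⟨m, hm⟩]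
    refine not_congr ⟨?_, fun h => h ⟨m, hm⟩ rfl⟩
    rintro h v rfl
    exact h
  · rw [hI.n]
    exact if_congr ⟨fun h v => h v v.2 v rfl, fun h m _ v _ => h v⟩ rfl rfl

theorem updateBest_exec (s : State) : (updateBest.exec s).answer =
    if s.reg 24 = 0 then s.answer else min s.answer (s.reg 23) := by
  by_cases h24 : s.reg 24 = 0
  · rw [if_pos h24, updateBest, LoopProgram.exec_ite_of_eq (e := .reg 24) (s := s) h24,
      LoopProgram.exec_skip]
  · rw [if_neg h24, updateBest, LoopProgram.exec_ite_of_ne (e := .reg 24) (s := s) h24]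
    by_cases h0 : s.reg 0 = 0
    · rw [LoopProgram.exec_ite_of_eq (e := .reg 0) (s := s) h0]
      simp [LoopProgram.exec_seq, LoopProgram.exec_assign, State.answer, h0]
    · rw [LoopProgram.exec_ite_of_ne (e := .reg 0) (s := s) h0]
      by_cases h : s.reg 1 ≤ s.reg 23
      · rw [LoopProgram.exec_ite_of_eq (by simp only [Expr.eval]; omega), LoopProgram.exec_skip]
        simp [State.answer, h0, h]
      · rw [LoopProgram.exec_ite_of_ne (by simp only [Expr.eval]; omega),
          LoopProgram.exec_assign]
        simp [State.answer, h0, (not_le.1 h).le]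

/-- The assignment `cur` is existential because `loadIni` resets array 4 only on the vertices; the
other cells are not controlled and need not be the same in all trials. -/
theorem trial_exec (hI : Loaded I s) (hs : s.reg 17 ≤ s.reg 14) (hb : 0 < s.reg 12) :
    ∃ cur : ℕ → ℕ, (∀ v : Fin I.n, cur v = I.ini v) ∧
    (Succeeds I (s.arr 3) (s.reg 12) (s.reg 13) (s.reg 17) cur → (trial.exec s).answer =
      min s.answer (simulate I (s.arr 3) (s.reg 12) (s.reg 13) (s.reg 17) cur).cost) ∧
    (¬ Succeeds I (s.arr 3) (s.reg 12) (s.reg 13) (s.reg 17) cur →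
      (trial.exec s).answer = s.answer) := by
  classical
  rw [trial]
  simp only [LoopProgram.exec_seq, LoopProgram.exec_assign]
  set s₁ := ((s.setReg 18 ((Expr.reg 17).eval s)).setReg 23
    ((Expr.const 0).eval (s.setReg 18 ((Expr.reg 17).eval s)))).setReg 24 ((Expr.const 1).eval
      ((s.setReg 18 ((Expr.reg 17).eval s)).setReg 23
        ((Expr.const 0).eval (s.setReg 18 ((Expr.reg 17).eval s))))) with hs₁
  have hI₁ : Loaded I s₁ := hI.of_eq (by simp [hs₁]) (by simp [hs₁])
  have a0 : s₁.reg 0 = s.reg 0 := by simp [hs₁]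
  have a1 : s₁.reg 1 = s.reg 1 := by simp [hs₁]
  have a12 : s₁.reg 12 = s.reg 12 := by simp [hs₁]
  have a13 : s₁.reg 13 = s.reg 13 := by simp [hs₁]
  have a14 : s₁.reg 14 = s.reg 14 := by simp [hs₁]
  have a18 : s₁.reg 18 = s.reg 17 := by simp [hs₁]
  have a23 : s₁.reg 23 = 0 := by simp [hs₁]
  have a24 : s₁.reg 24 = 1 := by simp [hs₁]
  have a3 : s₁.arr 3 = s.arr 3 := by simp [hs₁]
  clear_value s₁
  have hini := loadIni_exec hI₁
  set s₂ := loadIni.exec s₁ with hs₂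
  have hI₂ : Loaded I s₂ := hI₁.exec (by decide)
  have b0 : s₂.reg 0 = s.reg 0 := (LoopProgram.exec_reg (by decide) _).trans a0
  have b1 : s₂.reg 1 = s.reg 1 := (LoopProgram.exec_reg (by decide) _).trans a1
  have b12 : s₂.reg 12 = s.reg 12 := (LoopProgram.exec_reg (by decide) _).trans a12
  have b13 : s₂.reg 13 = s.reg 13 := (LoopProgram.exec_reg (by decide) _).trans a13
  have b14 : s₂.reg 14 = s.reg 14 := (LoopProgram.exec_reg (by decide) _).trans a14
  have b3 : s₂.arr 3 = s.arr 3 := (LoopProgram.exec_arr (by decide) _).trans a3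
  have hsim : simulation s₂ = ⟨s.reg 17, 0, 1, s₂.arr 4⟩ := by
    simp only [simulation, Simulation.mk.injEq, and_true]
    exact ⟨(LoopProgram.exec_reg (by decide) _).trans a18,
      (LoopProgram.exec_reg (by decide) _).trans a23,
      (LoopProgram.exec_reg (by decide) _).trans a24⟩
  clear_value s₂
  refine ⟨s₂.arr 4, hini, ?_⟩
  have hcode : s₂.reg 18 ≤ s₂.reg 14 := by
    have := congrArg Simulation.code hsim
    simp only [simulation] at this
    rwa [this, b14]
  have hm := moves_exec hI₂ hcode (by rwa [b12])
  rw [hsim, b3, b12, b13, ← simulate] at hm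
  set s₃ := (LoopProgram.rep 19 13 move).exec s₂ with hs₃
  have hI₃ : Loaded I s₃ := hI₂.exec (by decide)
  have c0 : s₃.reg 0 = s.reg 0 := (LoopProgram.exec_reg (by decide) _).trans b0
  have c1 : s₃.reg 1 = s.reg 1 := (LoopProgram.exec_reg (by decide) _).trans b1
  clear_value s₃
  have ht := targetTest_exec hI₃
  set s₄ := targetTest.exec s₃ with hs₄
  have d0 : s₄.reg 0 = s.reg 0 := (LoopProgram.exec_reg (by decide) _).trans c0
  have d1 : s₄.reg 1 = s.reg 1 := (LoopProgram.exec_reg (by decide) _).trans c1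
  have d23 : s₄.reg 23 = s₃.reg 23 := LoopProgram.exec_reg (by decide) _
  clear_value s₄
  have hans : s₄.answer = s.answer := by simp only [State.answer, d0, d1]
  rw [updateBest_exec, hans, Succeeds, ← hm, d23, ht]
  simp only [simulation]
  constructor
  · rintro ⟨h1, h2⟩
    rw [if_pos h2, if_neg h1]
  · intro h
    rw [if_pos]
    by_contra hc
    split_ifs at hc with h2
    · exact h ⟨hc, h2⟩
    · exact hc rfl

/-- The answer of the program is the length of a shortest reconfiguration sequence. -/
theorem search_exec {r : ℕ} (hI : Loaded I s) (hc : I.IsClassification (s.arr 3) r)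
    (hr : r < s.reg 12) (hk : I.k ≤ s.reg 12) (hm : I.k ^ r ≤ s.reg 13)
    (hX : (s.reg 12 * s.reg 12) ^ s.reg 13 ≤ s.reg 14) (h0 : s.answer = ⊤) :
    (search.exec s).answer = I.opt := by
  have hb : 0 < s.reg 12 := by omega
  have : (∀ N < s.reg 14, ∃ cur : ℕ → ℕ, (∀ v : Fin I.n, cur v = I.ini v) ∧
        (Succeeds I (s.arr 3) (s.reg 12) (s.reg 13) N cur → (search.exec s).answer ≤
          (simulate I (s.arr 3) (s.reg 12) (s.reg 13) N cur).cost)) ∧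
      I.opt ≤ (search.exec s).answer := by
    -- The current answer stays between the optimum and the cost of every successful code tried so
    -- far.
    refine LoopProgram.rep_induct (fun m s' =>
      (∀ N < m, ∃ cur : ℕ → ℕ, (∀ v : Fin I.n, cur v = I.ini v) ∧
        (Succeeds I (s.arr 3) (s.reg 12) (s.reg 13) N cur → s'.answer ≤
          (simulate I (s.arr 3) (s.reg 12) (s.reg 13) N cur).cost)) ∧ I.opt ≤ s'.answer)
      (by decide) ⟨by simp, ?_⟩ fun m s' hm' ha hs' ih => ?_
    · have : (s.setReg 17 0).answer = s.answer := by simp [State.answer]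
      rw [this, h0]
      exact le_top
    · have hI' := hI.of_agree ha (by decide)
      have h12 : s'.reg 12 = s.reg 12 := ha.1 12 (by decide)
      have h13 : s'.reg 13 = s.reg 13 := ha.1 13 (by decide)
      have h14 : s'.reg 14 = s.reg 14 := ha.1 14 (by decide)
      have h3 : s'.arr 3 = s.arr 3 := ha.2 3 (by decide)
      have hans : ((trial.exec s').setReg 17 (m + 1)).answer = (trial.exec s').answer := by
        simp [State.answer]
      obtain ⟨cur, hcur, h1, h2⟩ := trial_exec hI' (by rw [hs', h14]; exact hm'.le) (h12 ▸ hb)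
      rw [h3, h12, h13, hs'] at h1 h2
      rw [hans]
      by_cases hsuc : Succeeds I (s.arr 3) (s.reg 12) (s.reg 13) m cur
      · rw [h1 hsuc]
        refine ⟨fun N hN => ?_, le_min ih.2 (opt_le_of_succeeds hc hcur hsuc)⟩
        rcases Nat.lt_succ_iff_lt_or_eq.1 hN with hN | rfl
        · obtain ⟨cur', hcur', hle⟩ := ih.1 N hN
          exact ⟨cur', hcur', fun h => (min_le_left _ _).trans (hle h)⟩
        · exact ⟨cur, hcur, fun _ => min_le_right _ _⟩
      · rw [h2 hsuc]
        refine ⟨fun N hN => ?_, ih.2⟩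
        rcases Nat.lt_succ_iff_lt_or_eq.1 hN with hN | rfl
        · exact ih.1 N hN
        · exact ⟨cur, hcur, fun h => absurd h hsuc⟩
  exact le_antisymm (le_opt hc hr hk hm fun N hN => this.1 N (hN.trans_le hX)) this.2

end ReconfInstance

/-! ### Layout of the encoded input -/

theorem List.length_flatMap_of_length {α β : Type*} {l : List α} {g : α → List β} {m : ℕ}
    (hg : ∀ a, (g a).length = m) : (l.flatMap g).length = l.length * m := by
  induction l with
  | nil => simp
  | cons a l ih => simp [ih, hg, Nat.succ_mul, add_comm]

theorem List.getD_flatMap_of_length {α β : Type*} {l : List α} {g : α → List β} {m : ℕ}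
    (hg : ∀ a, (g a).length = m) {i j : ℕ} (hi : i < l.length) (hj : j < m) (d : β) :
    (l.flatMap g).getD (i * m + j) d = (g l[i]).getD j d := by
  induction l generalizing i with
  | nil => simp at hi
  | cons a l ih =>
    rw [List.flatMap_cons]
    cases i with
    | zero =>
      rw [List.getD_append _ _ _ _ (by rw [hg]; omega)]
      simp
    | succ i =>
      have h : (i + 1) * m + j = (g a).length + (i * m + j) := by rw [hg]; ring
      rw [h, List.getD_append_right _ _ _ _ (by omega), Nat.add_sub_cancel_left,
        ih (by simpa using hi)]
      rfl

namespace ReconfInstance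

open RAM ListColoring

variable {I : ReconfInstance} {s : State}

theorem length_encode (I : ReconfInstance) :
    I.encode.length = 2 + I.n * I.n + I.n * I.k + I.n + I.n := by
  simp only [encode, List.length_append, List.length_map, List.length_finRange]
  rw [List.length_flatMap_of_length (m := I.n) (by simp),
    List.length_flatMap_of_length (m := I.k) (by simp)]
  simp

open Classical in
theorem encode_getD_adj (I : ReconfInstance) (v w : Fin I.n) :
    I.encode.getD (2 + v * I.n + w) 0 = if I.graph.Adj v w then 1 else 0 := by
  have hlt : (v : ℕ) * I.n + w < I.n * I.n := by
    have := Nat.mul_le_mul_right I.n v.2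
    rw [Nat.succ_mul] at this
    omega
  rw [encode, List.append_assoc, List.append_assoc, List.append_assoc,
    List.getD_append_right _ _ _ _ (by simp; omega), List.getD_append]
  · rw [show 2 + (v : ℕ) * I.n + w - [I.n, I.k].length = v * I.n + w by simp; omega,
      List.getD_flatMap_of_length (by simp) (by simp) w.2]
    simp
  · rw [List.length_flatMap_of_length (m := I.n) (by simp)]
    simp only [List.length_finRange, List.length_cons, List.length_nil]
    omega

open Classical in
theorem encode_getD_list (I : ReconfInstance) (v : Fin I.n) (c : Fin I.k) :
    I.encode.getD (2 + I.n * I.n + v * I.k + c) 0 = if c ∈ I.lists v then 1 else 0 := by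
  have hlt : (v : ℕ) * I.k + c < I.n * I.k := by
    have := Nat.mul_le_mul_right I.k v.2
    rw [Nat.succ_mul] at this
    omega
  rw [encode, List.append_assoc, List.append_assoc, List.getD_append_right, List.getD_append]
  · rw [List.length_append, List.length_flatMap_of_length (m := I.n) (by simp)]
    simp only [List.length_finRange, List.length_cons, List.length_nil]
    rw [show 2 + I.n * I.n + (v : ℕ) * I.k + c - (0 + 1 + 1 + I.n * I.n) = v * I.k + c by omega,
      List.getD_flatMap_of_length (by simp) (by simp) c.2]
    simp
  · rw [List.length_append, List.length_flatMap_of_length (m := I.n) (by simp),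
      List.length_flatMap_of_length (m := I.k) (by simp)]
    simp only [List.length_finRange, List.length_cons, List.length_nil]
    omega
  · rw [List.length_append, List.length_flatMap_of_length (m := I.n) (by simp)]
    simp only [List.length_finRange, List.length_cons, List.length_nil]
    omega

theorem encode_getD_ini (I : ReconfInstance) (v : Fin I.n) :
    I.encode.getD (2 + I.n * I.n + I.n * I.k + v) 0 = I.ini v := by
  classical
  rw [encode, List.append_assoc, List.getD_append_right, List.getD_append]
  all_goals
    rw [List.length_append, List.length_append,
      List.length_flatMap_of_length (m := I.n) (by simp),
      List.length_flatMap_of_length (m := I.k) (by simp)]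
    simp only [List.length_finRange, List.length_cons, List.length_nil, List.length_map]
  · rw [show 2 + I.n * I.n + I.n * I.k + (v : ℕ) - (0 + 1 + 1 + I.n * I.n + I.n * I.k) = v by omega]
    simp
  · omega
  · omega

theorem encode_getD_tar (I : ReconfInstance) (v : Fin I.n) :
    I.encode.getD (2 + I.n * I.n + I.n * I.k + I.n + v) 0 = I.tar v := by
  classical
  rw [encode, List.getD_append_right]
  all_goals
    rw [List.length_append, List.length_append, List.length_append,
      List.length_flatMap_of_length (m := I.n) (by simp),
      List.length_flatMap_of_length (m := I.k) (by simp)]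
    simp only [List.length_finRange, List.length_cons, List.length_nil, List.length_map]
  · rw [show 2 + I.n * I.n + I.n * I.k + I.n + (v : ℕ) -
      (0 + 1 + 1 + I.n * I.n + I.n * I.k + I.n) = v by omega]
    simp
  · omega

/-- Register 0 initially holds the input length and has to be cleared, so that the answer starts as
`∞`. Register 5 starts at 2, the position of the first matrix row. -/
theorem header_exec (I : ReconfInstance) :
    (header.exec (State.init I.encode)).reg 0 = 0 ∧
    (header.exec (State.init I.encode)).reg 2 = I.n ∧
    (header.exec (State.init I.encode)).reg 3 = I.k ∧
    (header.exec (State.init I.encode)).reg 5 = 2 ∧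
    (header.exec (State.init I.encode)).arr 0 = fun i => I.encode.getD i 0 := by
  simp [header, LoopProgram.exec_seq, LoopProgram.exec_assign, State.init, encode]

theorem rowTable_exec {a x : ℕ} (hx : x ≠ 4 ∧ x ≠ 5) (s : State) :
    ((rowTable a x).exec s).reg 5 = s.reg 5 + s.reg 2 * s.reg x ∧
    ∀ v < s.reg 2, ((rowTable a x).exec s).arr a v = s.reg 5 + v * s.reg x := by
  refine LoopProgram.rep_induct (fun m s' => s'.reg 5 = s.reg 5 + m * s.reg x ∧
    ∀ v < m, s'.arr a v = s.reg 5 + v * s.reg x)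
    (by simp [LoopProgram.regs]) ⟨by simp, by simp⟩ fun m s' hm ha hs' ih => ?_
  have h2 : s'.reg x = s.reg x := ha.1 x (by simp [LoopProgram.regs, hx])
  simp only [LoopProgram.exec_seq, LoopProgram.exec_assign, LoopProgram.exec_store, Expr.eval,
    State.setReg_reg, State.setReg_arr, State.setArr_reg, State.setArr_arr, hs', h2, ih.1,
    true_and]
  norm_num
  refine ⟨by ring, fun v hv => ?_⟩
  split_ifs with h
  · rw [h]
  · exact ih.2 v (by omega)

theorem tables_exec (I : ReconfInstance) :
    Loaded I (tables.exec (header.exec (State.init I.encode))) := by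
  obtain ⟨-, h2, h3, h5, h0⟩ := header_exec I
  set s := header.exec (State.init I.encode)
  clear_value s
  simp only [tables, LoopProgram.exec_seq, LoopProgram.exec_assign, Expr.eval]
  obtain ⟨a5, a1⟩ := rowTable_exec (a := 1) (x := 2) (by decide) s
  have b2 : ((rowTable 1 2).exec s).reg 2 = I.n := (LoopProgram.exec_reg (by decide) _).trans h2
  have b3 : ((rowTable 1 2).exec s).reg 3 = I.k := (LoopProgram.exec_reg (by decide) _).trans h3
  have b0 := (LoopProgram.exec_arr (p := rowTable 1 2) (a := 0) (by decide) s).trans h0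
  set s₁ := (rowTable 1 2).exec s
  clear_value s₁
  obtain ⟨d5, d2⟩ := rowTable_exec (a := 2) (x := 3) (by decide) s₁
  have c2 : ((rowTable 2 3).exec s₁).reg 2 = I.n := (LoopProgram.exec_reg (by decide) _).trans b2
  have c3 : ((rowTable 2 3).exec s₁).reg 3 = I.k := (LoopProgram.exec_reg (by decide) _).trans b3
  have c0 := (LoopProgram.exec_arr (p := rowTable 2 3) (a := 0) (by decide) s₁).trans b0
  have c1 : ((rowTable 2 3).exec s₁).arr 1 = s₁.arr 1 := LoopProgram.exec_arr (by decide) _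
  set s₂ := (rowTable 2 3).exec s₁
  clear_value s₂
  rw [h2, h5] at a5 a1
  rw [b2, b3, a5] at d5 d2
  constructor
  · simp [c2]
  · simp [c3]
  · intro v w
    rw [← encode_getD_adj]
    simp [c0, c1, a1 v v.2]
  · intro v c
    rw [← encode_getD_list]
    simp [c0, d2 v v.2]
  · intro v
    rw [← encode_getD_ini]
    simp [c0, d5]
  · intro v
    rw [← encode_getD_tar]
    simp [c0, d5, c2]

/-- A bound for the contents of all registers that control loops, apart from the number of
vertices. -/
def loopBound (k : ℕ) : ℕ :=
  k + classBound k + (classBound k + k + 1) + (2 ^ classBound k) ^ k +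
    (4 ^ (2 ^ classBound k) ^ k) ^ (classBound k + k + 1)

/-! ### The parameter bound and the total running time -/

theorem primrec_loopBound : Primrec loopBound := by
  have pow : Primrec₂ ((· ^ ·) : ℕ → ℕ → ℕ) := Primrec₂.unpaired'.1 Nat.Primrec.pow
  have hc : Primrec classBound := by
    have h2 := pow.comp (.const 2) Primrec.id
    exact Primrec.nat_add.comp .id
      (Primrec.nat_mul.comp h2 (Primrec.nat_mul.comp h2 (Primrec.nat_mul.comp .id .id)))
  have hb : Primrec fun k => classBound k + k + 1 :=
    Primrec.succ.comp (Primrec.nat_add.comp hc .id)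
  have hm : Primrec fun k => (2 ^ classBound k) ^ k := pow.comp (pow.comp (.const 2) hc) .id
  exact Primrec.nat_add.comp (Primrec.nat_add.comp (Primrec.nat_add.comp
    (Primrec.nat_add.comp .id hc) hb) hm) (pow.comp (pow.comp (.const 4) hm) hb)

/-- The phases are timed separately, each with its own list `Y`, because the loop bounds of one
phase are computed by earlier ones and `WellFormed` forbids writing to a bound. Splitness enters
only through the bound on the number of classes. -/
theorem solver_correct (I : ReconfInstance) (hI : I.graph.IsSplitGraph) :
    ∃ t ≤ solver.time (I.n + loopBound I.k), ∃ s,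
      Run solver.compile (State.init I.encode) t s ∧ s.answer = I.opt := by
  obtain ⟨h0, h2, h3, -, -⟩ := header_exec I
  have hL := tables_exec I
  set m := I.n + loopBound I.k with hm
  obtain ⟨t₁, ht₁, hr₁⟩ := LoopProgram.exists_run (Y := []) (m := m) (p := header) (by decide)
    (s := State.init I.encode) (by simp)
  set s₁ := header.exec (State.init I.encode)
  clear_value s₁
  have hcl := classify_exec hL
  have hL₂ : Loaded I (classify.exec (tables.exec s₁)) := hL.exec (by decide)
  have hn : I.n ≤ m := by omega
  have hk : I.k ≤ m := by rw [hm, loopBound]; omega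
  obtain ⟨t₂, ht₂, hr₂⟩ := LoopProgram.exists_run (Y := [2, 3]) (m := m) (p := .seq tables classify)
    (by decide) (s := s₁) (by simp [h2, h3, hn, hk])
  rw [LoopProgram.exec_seq] at hr₂
  have a0 : (classify.exec (tables.exec s₁)).reg 0 = 0 :=
    ((LoopProgram.exec_reg (by decide) _).trans (LoopProgram.exec_reg (by decide) _)).trans h0
  set s₂ := classify.exec (tables.exec s₁)
  clear_value s₂
  have hr := hcl.le_classBound hI
  set r := s₂.reg 8 with hr8
  obtain ⟨t₃, ht₃, hr₃⟩ := LoopProgram.exists_run (Y := [3, 8]) (m := m) (p := moveBound)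
    (by decide) (s := s₂) (by
      simp only [List.mem_cons, List.not_mem_nil, or_false, forall_eq_or_imp, forall_eq, hL₂.k,
        ← hr8]
      refine ⟨hk, ?_⟩
      rw [hm, loopBound]
      omega)
  obtain ⟨hb12, hb13⟩ := moveBound_exec s₂
  have hL₃ : Loaded I (moveBound.exec s₂) := hL₂.exec (by decide)
  have b0 : (moveBound.exec s₂).reg 0 = 0 := (LoopProgram.exec_reg (by decide) _).trans a0
  have b3 : (moveBound.exec s₂).arr 3 = s₂.arr 3 := LoopProgram.exec_arr (by decide) _
  set s₃ := moveBound.exec s₂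
  clear_value s₃
  rw [hL₂.k, ← hr8] at hb12 hb13
  have hb : s₃.reg 12 ≤ classBound I.k + I.k + 1 := by omega
  have hM : s₃.reg 13 ≤ (2 ^ classBound I.k) ^ I.k := by
    rw [hb13]
    exact Nat.pow_le_pow_left (Nat.pow_le_pow_right (by omega) hr) _
  have hMm : s₃.reg 13 ≤ m := by rw [hm, loopBound]; omega
  obtain ⟨t₄, ht₄, hr₄⟩ := LoopProgram.exists_run (Y := [12, 13]) (m := m) (p := codeBound)
    (by decide) (s := s₃) (by
      simp only [List.mem_cons, List.not_mem_nil, or_false, forall_eq_or_imp, forall_eq]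
      refine ⟨?_, hMm⟩
      rw [hm, loopBound]
      omega)
  have hX := codeBound_exec s₃
  have hL₄ : Loaded I (codeBound.exec s₃) := hL₃.exec (by decide)
  have c0 : (codeBound.exec s₃).reg 0 = 0 := (LoopProgram.exec_reg (by decide) _).trans b0
  have c12 : (codeBound.exec s₃).reg 12 = s₃.reg 12 := LoopProgram.exec_reg (by decide) _
  have c13 : (codeBound.exec s₃).reg 13 = s₃.reg 13 := LoopProgram.exec_reg (by decide) _
  have c3 : (codeBound.exec s₃).arr 3 = s₂.arr 3 := (LoopProgram.exec_arr (by decide) _).trans b3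
  set s₄ := codeBound.exec s₃
  clear_value s₄
  have hXm : s₄.reg 14 ≤ m := by
    have : s₄.reg 14 ≤ (4 ^ (2 ^ classBound I.k) ^ I.k) ^ (classBound I.k + I.k + 1) := by
      rw [hX]
      exact (Nat.pow_le_pow_left (Nat.pow_le_pow_right (by omega) hM) _).trans
        (Nat.pow_le_pow_right (by positivity) hb)
    rw [hm, loopBound]
    omega
  obtain ⟨t₅, ht₅, hr₅⟩ := LoopProgram.exists_run (Y := [2, 3, 13, 14]) (m := m) (p := search)
    (by decide) (s := s₄) (by
      simp only [List.mem_cons, List.not_mem_nil, or_false, forall_eq_or_imp, forall_eq, hL₄.n,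
        hL₄.k, c13]
      exact ⟨hn, hk, hMm, hXm⟩)
  refine ⟨t₁ + (t₂ + (t₃ + (t₄ + t₅))), ?_, _, .seq hr₁ (.seq hr₂ (.seq hr₃ (.seq hr₄ hr₅))), ?_⟩
  · simp only [solver, LoopProgram.time] at ht₁ ht₂ ht₃ ht₄ ht₅ ⊢
    omega
  · refine search_exec (r := r) hL₄ (by rwa [c3]) (by omega) (by omega) ?_ ?_ ?_
    -- From `k ≤ 2 ^ k` follows `k ^ r ≤ (2 ^ r) ^ k`, the number of moves computed by doubling.
    · rw [c13, hb13, ← pow_mul, mul_comm, pow_mul]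
      exact Nat.pow_le_pow_left Nat.lt_two_pow_self.le _
    -- Here `b ≤ 2 ^ b` gives `b * b ≤ 4 ^ b`, so register 14 covers all codes of `m` moves.
    · rw [hX, c12, c13, ← pow_mul, mul_comm (s₃.reg 13), pow_mul]
      refine Nat.pow_le_pow_left ?_ _
      rw [show 4 = 2 * 2 from rfl, mul_pow]
      exact Nat.mul_le_mul Nat.lt_two_pow_self.le Nat.lt_two_pow_self.le
    · simp [State.answer, c0]

end ReconfInstance

theorem corollary2 :
    IsFixedParameterTractable {I : ReconfInstance | I.graph.IsSplitGraph}
      ReconfInstance.encode ReconfInstance.k ReconfInstance.opt := by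
  obtain ⟨A, d, hA⟩ := ReconfInstance.solver.exists_time_le
  refine ⟨ReconfInstance.solver.compile, fun k => A * (ReconfInstance.loopBound k + 1) ^ d, d, ?_,
    fun I hI => ?_⟩
  · have pow : Primrec₂ ((· ^ ·) : ℕ → ℕ → ℕ) := Primrec₂.unpaired'.1 Nat.Primrec.pow
    exact (Primrec.nat_mul.comp (.const A)
      (pow.comp (Primrec.succ.comp ReconfInstance.primrec_loopBound) (.const d))).to_comp
  · obtain ⟨t, ht, s, hr, hs⟩ := ReconfInstance.solver_correct I hI
    refine ⟨t, s, hr, ht.trans ((hA _).trans ?_), hs⟩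
    rw [mul_assoc, ← mul_pow]
    refine Nat.mul_le_mul_left _ (Nat.pow_le_pow_left ?_ _)
    have h1 : I.n + 1 ≤ I.encode.length := by
      rw [ReconfInstance.length_encode]
      omega
    -- The sum is bounded by a product, which separates the parameter from the input size after
    -- raising to the power `d`.
    calc I.n + ReconfInstance.loopBound I.k + 1 ≤ (ReconfInstance.loopBound I.k + 1) * (I.n + 1) := by
            ring_nf
            omega
      _ ≤ _ := Nat.mul_le_mul_left _ h1
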